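/- **Setting.** Let $\Omega$ and $\mathcal X$ be metric spaces with their Borel $\sigma$-algebras, $\mu$ a Borel probability measure on $\Omega$ with compact support, and $(\Phi^t)_{t\ge 0}$ a semigroup ($\Phi^0=\mathrm{id}$, $\Phi^{s+t}=\Phi^s\circ\Phi^t$) of continuous $\mu$-preserving maps $\Omega\to\Omega$. Let $X:\Omega\to\mathcal X$ (covariate) and $Y:\Omega\to\mathbb C$ (response) be continuous, $U^\tau Y=Y\circ\Phi^\tau$, and $\mu_X=X_*\mu$. Fix $\Delta t>0$ and $\omega_1\in\Omega$, and put $\omega_j=\Phi^{(j-1)\Delta t}(\omega_1)$, $x_j=X(\omega_j)$, $y_j=Y(\omega_j)$, $\mu_n=\frac1n\sum_{j=1}^n\delta_{\omega_j}$, $\mu_{X,n}=\frac1n\sum_{j=1}^n\delta_{x_j}$. Inner products are conjugate-linear in the first argument. *Assumptions.* (a) $\int g\,d\mu_n\to\int g\,d\mu$ for every bounded continuous $g:\Omega\to\mathbb C$. (b) $\mathcal U\subseteq\mathcal X$ is a compact set containing $\operatorname{supp}\mu_X$ and all $x_j$, and for every $q\in\mathbb N_0$ the function $U^{q\Delta t}Y$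 is bounded on $X^{-1}(\mathcal U)$. (c) $\mathcal K$ and $\mathcal K_n$ ($n\in\mathbb N$) are reproducing kernel Hilbert spaces of complex functions on $\mathcal X$ with continuous kernels $k$, $k_n$, where $k(x,x')=\langle k_x,k_{x'}\rangle_{\mathcal K}$ and $f(x)=\langle k_x,f\rangle_{\mathcal K}$ (similarly for $k_n$), and $k_n\to k$ uniformly on $\mathcal U\times\mathcal U$. *Ideal target function.* Let $\iota:\mathcal K\to L^2(\mu_X)$ be the embedding, $G=\iota\iota^*$, $\lambda_1\ge\lambda_2\ge\cdots\ge 0$ the positive eigenvalues of $G$ repeated by multiplicity (followed by zeros if there are finitely many), $\phi_i$ corresponding orthonormal eigenfunctions, and $\psi_i=\lambda_i^{-1/2}\iota^*\phi_i$ for $\lambda_i>0$. Let $\Xi:L^2(\mu_X)\to L^2(\mu)$, $\Xi f=f\circ X$, and let $Z_\tau=\Xi^*U^\tau Y$ be the regression function. Put $$f_{\tau,\ell}=\sum_{i\le\ell,\ \lambda_i>0}\frac{\langle\phi_i,Z_\tau\rangle_{L^2(\mu_X)}}{\lambda_i^{1/2}}\,\psi_i\in\mathcal K ;$$ if $\lambda_\ell>0$,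 this is the unique minimizer of $\|\iota f-Z_\tau\|^2_{L^2(\mu_X)}$ over $f\in\operatorname{span}\{\psi_1,\dots,\psi_\ell\}$. *Empirical target function.* For $\tau=q\,\Delta t$, $q\in\mathbb N_0$, let $\iota_n:\mathcal K_n\to L^2(\mu_{X,n})$ be the embedding and let $\lambda_{i,n},\phi_{i,n},\psi_{i,n}$ be obtained from $G_n=\iota_n\iota_n^*$ in the same way. Let $\boldsymbol y_\tau=(y_{1+q},\dots,y_n,0,\dots,0)\in\mathbb C^n$, where $\mathbb C^n$ carries the normalized dot product, let $\Xi_n:L^2(\mu_{X,n})\to\mathbb C^n$, $\Xi_nf=(f(x_1),\dots,f(x_n))$, and $Z_{\tau,n}=\Xi_n^*\boldsymbol y_\tau$. Then $f_{\tau,\ell,n}=\sum_{i\le\ell,\ \lambda_{i,n}>0}\lambda_{i,n}^{-1/2}\langle\phi_{i,n},Z_{\tau,n}\rangle_{L^2(\mu_{X,n})}\,\psi_{i,n}\in\mathcal K_n$; if $\lambda_{\ell,n}>0$, it is the unique minimizer of $\|\iota_nf-Z_{\tau,n}\|^2_{L^2(\mu_{X,n})}$ over $f\in\operatorname{span}\{\psi_{1,n},\dots,\psi_{\ell,n}\}$.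 **Theorem.** Under these assumptions, for any choice of the orthonormal eigenfunctions: 1. For every $\tau\ge0$, $U^\tau Y\in L^2(\mu)$ and $\mathbb E[U^\tau Y\mid X]=Z_\tau\circ X$ $\mu$-a.e. 2. For every $\ell\ge1$ with $\lambda_\ell>0$ and $\lambda_{\ell+1}<\lambda_\ell$ (in particular whenever $\lambda_1,\dots,\lambda_\ell$ are positive and simple), and every $\tau=q\,\Delta t$, $q\in\mathbb N_0$, $f_{\tau,\ell,n}\to f_{\tau,\ell}$ as $n\to\infty$, uniformly on $\mathcal U$. The convergence is also uniform over the lead times $\tau=q\,\Delta t$ in any compact subset of $[0,\infty)$. 3. If $k$ is $L^2(\mu_X)$-strictly-positive (i.e. $\langle f,Gf\rangle>0$ for all nonzero $f\in L^2(\mu_X)$), then for every $\tau\ge0$, $\iota f_{\tau,\ell}\to Z_\tau$ in $L^2(\mu_X)$ as $\ell\to\infty$. The convergence is uniform over the lead times $\tau=q\,\Delta t$, $q\in\mathbb N_0$, in any compact subset of $[0,\infty)$; and if moreover $t\mapsto\Phi^t(\omega)$ is continuous for every $\omega\in\Omega$, it is uniform over all $\tau$ in any compact subset of $[0,\infty)$.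 Together, 2 and 3 give, for lead times $\tau=q\,\Delta t$, the iterated limit $\lim_{\ell}\lim_{n} f_{\tau,\ell,n}=\lim_{\ell} f_{\tau,\ell}=Z_\tau$, with the $n$-limit in $C(\mathcal U)$ (for $\ell$ as in 2) and the $\ell$-limit in $L^2(\mu_X)$. -/

import Mathlib

open MeasureTheory Filter Topology Set
open scoped NNReal ENNReal InnerProductSpace

namespace KAF

noncomputable section

/-! ### The spaces `L²(ρ)` and the pullback along a measurable map -/

/-- The `L²(μ)` class of a function `g` that is square integrable for `μ`
(and `0` for a function that is not). -/
def toL2 {S : Type*} [MeasurableSpace S] (μ : Measure S) (g : S → ℂ) : Lp ℂ 2 μ :=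
  open Classical in if h : MemLp g 2 μ then h.toLp g else 0

/-- The isometric embedding `Ξ : L²(μ_X) → L²(μ)`, `Ξ f = f ∘ X`, where `μ_X` is the
pushforward of `μ` under `X`. -/
def pullback {S T : Type*} [MeasurableSpace S] [MeasurableSpace T] (μ : Measure S)
    {X : S → T} (hX : Measurable X) : Lp ℂ 2 (μ.map X) →L[ℂ] Lp ℂ 2 μ :=
  (Lp.compMeasurePreservingₗᵢ ℂ X (hX.measurePreserving μ)).toContinuousLinearMap

/-- The regression function `Z = Ξ* g ∈ L²(μ_X)` of the response `g ∈ L²(μ)` given the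
covariate `X`. -/
def regression {S T : Type*} [MeasurableSpace S] [MeasurableSpace T] (μ : Measure S)
    {X : S → T} (hX : Measurable X) (g : S → ℂ) : Lp ℂ 2 (μ.map X) :=
  ContinuousLinearMap.adjoint (pullback μ hX) (toL2 μ g)

/-! ### Reproducing kernel Hilbert spaces and their embedding into `L²(ρ)` -/

/-- The complex-valued reproducing kernel `k(x, y) = ⟨k_x, k_y⟩` of an RKHS of complex functions
(inner products are conjugate-linear in the first argument). -/
def scalarKernel {𝒳 : Type*} (𝓚 : Type*) [NormedAddCommGroup 𝓚] [InnerProductSpace ℂ 𝓚]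
    [CompleteSpace 𝓚] [RKHS ℂ 𝓚 𝒳 ℂ] (x y : 𝒳) : ℂ :=
  RKHS.kernel 𝓚 x y 1

/-- If all elements of the RKHS are square integrable, the map taking a function to its `L²(ρ)`
class is a bounded operator (closed graph theorem). -/
def inclOfMemLp {𝒳 : Type*} [MeasurableSpace 𝒳] {𝓚 : Type*} [NormedAddCommGroup 𝓚]
    [InnerProductSpace ℂ 𝓚] [CompleteSpace 𝓚] [RKHS ℂ 𝓚 𝒳 ℂ] {ρ : Measure 𝒳}
    (h : ∀ f : 𝓚, MemLp (⇑f) 2 ρ) : 𝓚 →L[ℂ] Lp ℂ 2 ρ :=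
  let L : 𝓚 →ₗ[ℂ] Lp ℂ 2 ρ :=
    { toFun := fun f => (h f).toLp _
      map_add' := fun f g => by
        rw [← MemLp.toLp_add]
        exact MemLp.toLp_congr _ _ (by simp)
      map_smul' := fun c f => by
        rw [RingHom.id_apply, ← MemLp.toLp_const_smul]
        exact MemLp.toLp_congr _ _ (by simp) }
  { toLinearMap := L
    cont := by
      apply LinearMap.continuous_of_seq_closed_graph
      intro u x y hu hy
      obtain ⟨ns, _, hns⟩ :=
        (tendstoInMeasure_of_tendsto_Lp hy).exists_seq_tendsto_ae
      refine Lp.ext ?_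
      have h1 : ∀ᵐ a ∂ρ, ∀ i, (L (u (ns i)) : 𝒳 → ℂ) a = u (ns i) a :=
        ae_all_iff.2 fun i => (h (u (ns i))).coeFn_toLp
      filter_upwards [hns, h1, (h x).coeFn_toLp] with a ha1 ha2 ha3
      have h2 : Tendsto (fun i => u (ns i) a) atTop (𝓝 (x a)) :=
        ((RKHS.continuous_eval (𝕜 := ℂ) a).tendsto x).comp
          (hu.comp (StrictMono.tendsto_atTop ‹StrictMono ns›))
      have h3 : Tendsto (fun i => u (ns i) a) atTop (𝓝 (y a)) := by
        simpa [ha2] using ha1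
      rw [tendsto_nhds_unique h3 h2]
      exact ha3.symm }

/-- The embedding `ι_ρ : 𝓚 → L²(ρ)` of an RKHS whose elements are all square integrable for `ρ`
(and `0` if some element is not; `memLp_of_continuous_kernel` below shows that
this does not occur for a continuous kernel and a finite measure carried by a compact set). -/
def incl {𝒳 : Type*} [MeasurableSpace 𝒳] (𝓚 : Type*) [NormedAddCommGroup 𝓚]
    [InnerProductSpace ℂ 𝓚] [CompleteSpace 𝓚] [RKHS ℂ 𝓚 𝒳 ℂ] (ρ : Measure 𝒳) :
    𝓚 →L[ℂ] Lp ℂ 2 ρ :=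
  open Classical in if h : ∀ f : 𝓚, MemLp (⇑f) 2 ρ then inclOfMemLp h else 0

theorem coeFn_incl {𝒳 : Type*} [MeasurableSpace 𝒳] {𝓚 : Type*} [NormedAddCommGroup 𝓚]
    [InnerProductSpace ℂ 𝓚] [CompleteSpace 𝓚] [RKHS ℂ 𝓚 𝒳 ℂ] {ρ : Measure 𝒳}
    (h : ∀ f : 𝓚, MemLp (⇑f) 2 ρ) (f : 𝓚) : (incl 𝓚 ρ f : 𝒳 → ℂ) =ᵐ[ρ] ⇑f := by
  rw [incl, dif_pos h]
  exact (h f).coeFn_toLp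

theorem inner_kerFun_eq_scalarKernel {𝒳 : Type*} (𝓚 : Type*) [NormedAddCommGroup 𝓚]
    [InnerProductSpace ℂ 𝓚] [CompleteSpace 𝓚] [RKHS ℂ 𝓚 𝒳 ℂ] (x y : 𝒳) :
    ⟪RKHS.kerFun 𝓚 x (1 : ℂ), RKHS.kerFun 𝓚 y (1 : ℂ)⟫_ℂ = scalarKernel 𝓚 x y := by
  rw [RKHS.kerFun_inner, RKHS.kerFun_apply, scalarKernel]
  simp

/-- Elements of an RKHS with a continuous kernel are continuous functions. -/
theorem continuous_of_continuous_kernel {𝒳 : Type*} [TopologicalSpace 𝒳] {𝓚 : Type*}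
    [NormedAddCommGroup 𝓚] [InnerProductSpace ℂ 𝓚] [CompleteSpace 𝓚] [RKHS ℂ 𝓚 𝒳 ℂ]
    (hk : Continuous fun p : 𝒳 × 𝒳 => scalarKernel 𝓚 p.1 p.2) (f : 𝓚) : Continuous (⇑f) := by
  obtain ⟨κ, hκ⟩ : ∃ κ : 𝒳 → 𝓚, κ = fun x => RKHS.kerFun 𝓚 x (1 : ℂ) := ⟨_, rfl⟩
  have hK : ∀ x y, ⟪κ x, κ y⟫_ℂ = scalarKernel 𝓚 x y := by
    intro x y
    rw [hκ]
    exact inner_kerFun_eq_scalarKernel 𝓚 x y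
  have hf : (⇑f) = fun x => ⟪κ x, f⟫_ℂ := by
    funext x
    rw [hκ, RKHS.kerFun_inner]
    simp
  have hc : Continuous κ := by
    rw [continuous_iff_continuousAt]
    intro x
    rw [ContinuousAt, tendsto_iff_norm_sub_tendsto_zero]
    have h1 : ∀ y, ‖κ y - κ x‖ = Real.sqrt (scalarKernel 𝓚 y y - scalarKernel 𝓚 y x
        - scalarKernel 𝓚 x y + scalarKernel 𝓚 x x).re := by
      intro y
      rw [← hK, ← hK, ← hK, ← hK, ← inner_sub_sub_self, norm_eq_sqrt_re_inner (𝕜 := ℂ)]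
      rfl
    have h2 : Continuous fun y => Real.sqrt (scalarKernel 𝓚 y y - scalarKernel 𝓚 y x
        - scalarKernel 𝓚 x y + scalarKernel 𝓚 x x).re := by
      have a1 := hk.comp (continuous_id.prodMk continuous_id)
      have a2 := hk.comp (continuous_id.prodMk (continuous_const (y := x)))
      have a3 := hk.comp ((continuous_const (y := x)).prodMk continuous_id)
      simp only [Function.comp_def, id] at a1 a2 a3
      exact Real.continuous_sqrt.comp
        (Complex.continuous_re.comp (((a1.sub a2).sub a3).add continuous_const))
    have h3 := h2.tendsto x
    rw [← h1 x, sub_self, norm_zero] at h3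
    exact h3.congr fun y => (h1 y).symm
  rw [hf]
  exact hc.inner continuous_const

theorem memLp_of_continuous_kernel {𝒳 : Type*} [MetricSpace 𝒳] [MeasurableSpace 𝒳]
    [BorelSpace 𝒳] {𝓚 : Type*} [NormedAddCommGroup 𝓚] [InnerProductSpace ℂ 𝓚]
    [CompleteSpace 𝓚] [RKHS ℂ 𝓚 𝒳 ℂ]
    (hk : Continuous fun p : 𝒳 × 𝒳 => scalarKernel 𝓚 p.1 p.2) (ρ : Measure 𝒳)
    [IsFiniteMeasure ρ] {U : Set 𝒳} (hU : IsCompact U) (hρ : ρ Uᶜ = 0) (f : 𝓚) :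
    MemLp (⇑f) 2 ρ := by
  have hf := continuous_of_continuous_kernel hk f
  obtain ⟨C, hC⟩ := hU.exists_bound_of_continuousOn hf.continuousOn
  refine MemLp.of_bound hf.measurable.aestronglyMeasurable C ?_
  have : ∀ᵐ x ∂ρ, x ∈ U := hρ
  filter_upwards [this] with x hx using hC x hx

/-- The integral operator `G_ρ = ι_ρ ι_ρ*` on `L²(ρ)` induced by an RKHS. -/
def kernelOp {𝒳 : Type*} [MeasurableSpace 𝒳] (𝓚 : Type*) [NormedAddCommGroup 𝓚]
    [InnerProductSpace ℂ 𝓚] [CompleteSpace 𝓚] [RKHS ℂ 𝓚 𝒳 ℂ] (ρ : Measure 𝒳) :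
    Lp ℂ 2 ρ →L[ℂ] Lp ℂ 2 ρ :=
  incl 𝓚 ρ ∘L ContinuousLinearMap.adjoint (incl 𝓚 ρ)

/-- The reproducing kernel of `𝓚` is `L²(ρ)`-strictly-positive: `G_ρ` is a strictly positive
operator. -/
def IsL2StrictlyPositive {𝒳 : Type*} [MeasurableSpace 𝒳] (𝓚 : Type*) [NormedAddCommGroup 𝓚]
    [InnerProductSpace ℂ 𝓚] [CompleteSpace 𝓚] [RKHS ℂ 𝓚 𝒳 ℂ] (ρ : Measure 𝒳) : Prop :=
  ∀ f : Lp ℂ 2 ρ, f ≠ 0 → 0 < (⟪f, kernelOp 𝓚 ρ f⟫_ℂ).re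

/-! ### Eigenfunctions, hypothesis spaces, target functions -/

/-- `lam 0 ≥ lam 1 ≥ …` is the list of all positive eigenvalues of the positive compact operator
`G`, repeated according to multiplicity and followed by zeros if there are only finitely many,
and the `φ i` with `lam i > 0` are corresponding orthonormal eigenvectors. Completeness says that
`G` vanishes on the orthogonal complement of these eigenvectors. The vectors `φ i` with
`lam i = 0` play no role. Indices start at `0`. -/
structure IsEigensystem {H : Type*} [NormedAddCommGroup H] [InnerProductSpace ℂ H]
    (G : H →L[ℂ] H) (lam : ℕ → ℝ) (φ : ℕ → H) : Prop where
  antitone : Antitone lam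
  nonneg : ∀ i, 0 ≤ lam i
  orthonormal : Orthonormal ℂ fun i : {i : ℕ // 0 < lam i} => φ i
  eigen : ∀ i, 0 < lam i → G (φ i) = (lam i : ℂ) • φ i
  complete : ∀ f : H, (∀ i, 0 < lam i → ⟪φ i, f⟫_ℂ = 0) → G f = 0

/-- `ψ_i = ι* φ_i / λ_i ^ (1/2)`. -/
def psi {𝓚 H : Type*} [NormedAddCommGroup 𝓚] [InnerProductSpace ℂ 𝓚] [CompleteSpace 𝓚]
    [NormedAddCommGroup H] [InnerProductSpace ℂ H] [CompleteSpace H]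
    (ι : 𝓚 →L[ℂ] H) (lam : ℕ → ℝ) (φ : ℕ → H) (i : ℕ) : 𝓚 :=
  ((Real.sqrt (lam i) : ℂ)⁻¹) • ContinuousLinearMap.adjoint ι (φ i)

/-- The hypothesis space spanned by the first `ℓ` of the `ψ_i`. -/
def hypothesisSpace {𝓚 H : Type*} [NormedAddCommGroup 𝓚] [InnerProductSpace ℂ 𝓚]
    [CompleteSpace 𝓚] [NormedAddCommGroup H] [InnerProductSpace ℂ H] [CompleteSpace H]
    (ι : 𝓚 →L[ℂ] H) (lam : ℕ → ℝ) (φ : ℕ → H) (ℓ : ℕ) : Submodule ℂ 𝓚 :=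
  Submodule.span ℂ (psi ι lam φ '' {i | i < ℓ})

/-- The target function `T_ℓ Z = ∑_{i < ℓ} ⟨φ_i, Z⟩ / λ_i ^ (1/2) • ψ_i`, an element of the RKHS;
terms with `λ_i = 0` do not contribute. It is the unique minimizer of the excess error
`‖ι f - Z‖²` over the hypothesis space, see `target_minimizes`. -/
def target {𝓚 H : Type*} [NormedAddCommGroup 𝓚] [InnerProductSpace ℂ 𝓚] [CompleteSpace 𝓚]
    [NormedAddCommGroup H] [InnerProductSpace ℂ H] [CompleteSpace H]
    (ι : 𝓚 →L[ℂ] H) (lam : ℕ → ℝ) (φ : ℕ → H) (ℓ : ℕ) (Z : H) : 𝓚 :=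
  ∑ i ∈ Finset.range ℓ, (⟪φ i, Z⟫_ℂ / (Real.sqrt (lam i) : ℂ)) • psi ι lam φ i

theorem target_minimizes {𝓚 H : Type*} [NormedAddCommGroup 𝓚] [InnerProductSpace ℂ 𝓚]
    [CompleteSpace 𝓚] [NormedAddCommGroup H] [InnerProductSpace ℂ H] [CompleteSpace H]
    {ι : 𝓚 →L[ℂ] H} {lam : ℕ → ℝ} {φ : ℕ → H}
    (h : IsEigensystem (ι ∘L ContinuousLinearMap.adjoint ι) lam φ) {ℓ : ℕ}
    (hℓ : ∀ i < ℓ, 0 < lam i) (Z : H) :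
    target ι lam φ ℓ Z ∈ hypothesisSpace ι lam φ ℓ ∧
      ∀ g ∈ hypothesisSpace ι lam φ ℓ, g ≠ target ι lam φ ℓ Z →
        ‖ι (target ι lam φ ℓ Z) - Z‖ ^ 2 < ‖ι g - Z‖ ^ 2 := by
  have hmem : target ι lam φ ℓ Z ∈ hypothesisSpace ι lam φ ℓ :=
    Submodule.sum_mem _ fun i hi => Submodule.smul_mem _ _
      (Submodule.subset_span ⟨i, Finset.mem_range.1 hi, rfl⟩)
  refine ⟨hmem, fun g hg hne => ?_⟩
  have hs : ∀ i < ℓ, (Real.sqrt (lam i) : ℂ) ≠ 0 := fun i hi => by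
    exact_mod_cast (Real.sqrt_pos.2 (hℓ i hi)).ne'
  have hsq : ∀ i < ℓ, (lam i : ℂ) = (Real.sqrt (lam i) : ℂ) * (Real.sqrt (lam i) : ℂ) :=
    fun i hi => by exact_mod_cast (Real.mul_self_sqrt (hℓ i hi).le).symm
  have hψ : ∀ i < ℓ, ι (psi ι lam φ i) = (Real.sqrt (lam i) : ℂ) • φ i := by
    intro i hi
    have := h.eigen i (hℓ i hi)
    simp only [ContinuousLinearMap.comp_apply] at this
    rw [psi, map_smul, this, smul_smul, hsq i hi, inv_mul_cancel_left₀ (hs i hi)]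
  have hort : ∀ i < ℓ, ∀ j < ℓ, ⟪φ i, φ j⟫_ℂ = if i = j then 1 else 0 := by
    intro i hi j hj
    have := orthonormal_iff_ite.1 h.orthonormal ⟨i, hℓ i hi⟩ ⟨j, hℓ j hj⟩
    simpa using this
  have hT : ι (target ι lam φ ℓ Z) = ∑ i ∈ Finset.range ℓ, ⟪φ i, Z⟫_ℂ • φ i := by
    rw [target, map_sum]
    refine Finset.sum_congr rfl fun i hi => ?_
    have hi := Finset.mem_range.1 hi
    rw [map_smul, hψ i hi, smul_smul, div_mul_cancel₀ _ (hs i hi)]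
  have hperp : ∀ i < ℓ, ⟪φ i, ι (target ι lam φ ℓ Z) - Z⟫_ℂ = 0 := by
    intro i hi
    rw [inner_sub_right, hT, inner_sum, Finset.sum_congr rfl (g := fun j =>
      if i = j then ⟪φ j, Z⟫_ℂ else 0)]
    · simp [hi]
    · intro j hj
      rw [inner_smul_right, hort i hi j (Finset.mem_range.1 hj)]
      simp
  have hperp' : ∀ d ∈ hypothesisSpace ι lam φ ℓ,
      ⟪ι d, ι (target ι lam φ ℓ Z) - Z⟫_ℂ = 0 := by
    intro d hd
    induction hd using Submodule.span_induction with
    | mem x hx =>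
      obtain ⟨i, hi, rfl⟩ := hx
      rw [hψ i hi, inner_smul_left, hperp i hi, mul_zero]
    | zero => simp
    | add x y _ _ hx hy => rw [map_add, inner_add_left, hx, hy, add_zero]
    | smul a x _ hx => rw [map_smul, inner_smul_left, hx, mul_zero]
  have hd : g - target ι lam φ ℓ Z ∈ hypothesisSpace ι lam φ ℓ := Submodule.sub_mem _ hg hmem
  have hinj : ι (g - target ι lam φ ℓ Z) ≠ 0 := by
    intro h0
    apply hne
    rw [← sub_eq_zero]
    have : ∀ e ∈ hypothesisSpace ι lam φ ℓ, ⟪e, g - target ι lam φ ℓ Z⟫_ℂ = 0 := by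
      intro e he
      induction he using Submodule.span_induction with
      | mem x hx =>
        obtain ⟨i, hi, rfl⟩ := hx
        rw [psi, inner_smul_left, ContinuousLinearMap.adjoint_inner_left, h0, inner_zero_right,
          mul_zero]
      | zero => simp
      | add x y _ _ hx hy => rw [inner_add_left, hx, hy, add_zero]
      | smul a x _ hx => rw [inner_smul_left, hx, mul_zero]
    exact inner_self_eq_zero.1 (this _ hd)
  have hsplit : ι g - Z = ι (g - target ι lam φ ℓ Z) + (ι (target ι lam φ ℓ Z) - Z) := by
    rw [map_sub]; abel
  have hpyth := norm_add_sq_eq_norm_sq_add_norm_sq_of_inner_eq_zero _ _ (hperp' _ hd)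
  rw [hsplit, sq, sq, hpyth]
  have := norm_pos_iff.2 hinj
  nlinarith

/-! ### Sampling along an orbit -/

/-- The uniform probability measure on `n` sample indices; `L²` of it is `ℂⁿ` with the normalized
dot product. -/
def indexMeasure (n : ℕ) : Measure (Fin n) := (n : ℝ≥0∞)⁻¹ • Measure.count

/-- The empirical measure `(1/n) ∑_{j < n} δ_{p j}` of a sequence of points `p`, as the law of
`p` under the uniform measure on the indices (see `empMeasure_eq_sum_dirac`). -/
def empMeasure {S : Type*} [MeasurableSpace S] (p : ℕ → S) (n : ℕ) : Measure S :=
  (indexMeasure n).map fun j : Fin n => p j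

theorem empMeasure_eq_sum_dirac {S : Type*} [MeasurableSpace S] (p : ℕ → S) (n : ℕ) :
    empMeasure p n = (n : ℝ≥0∞)⁻¹ • ∑ j ∈ Finset.range n, Measure.dirac (p j) := by
  have hm : Measurable fun j : Fin n => p j := Measurable.of_discrete
  ext s hs
  rw [empMeasure, indexMeasure, Measure.map_smul, Measure.smul_apply, Measure.smul_apply,
    Measure.map_apply hm hs, Measure.count_apply (hm hs), Measure.finsetSum_apply,
    ← Fin.sum_univ_eq_sum_range (fun j => Measure.dirac (p j) s) n]
  congr 1
  rw [← MeasureTheory.lintegral_indicator_one (hm hs) |>.trans (Measure.count_apply (hm hs)),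
    MeasureTheory.lintegral_count, tsum_fintype]
  refine Finset.sum_congr rfl fun j _ => ?_
  rw [Measure.dirac_apply' _ hs]
  rfl

/-- The sampled orbit; index `j` is the `(j+1)`-st sample. -/
def orbit {Ω : Type*} (Φ : ℝ≥0 → Ω → Ω) (Δt : ℝ≥0) (ω₁ : Ω) (j : ℕ) : Ω := Φ (j * Δt) ω₁

/-- The analog vector `(y_{1+q}, …, y_n, 0, …, 0) ∈ ℂⁿ`: the observations `y` shifted by `q`
steps. -/
def analogVec (y : ℕ → ℂ) (q n : ℕ) (j : Fin n) : ℂ := if (j : ℕ) + q < n then y (j + q) else 0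

/-- The empirical regression function `Z_{τ,n} ∈ L²(μ_{X,n})`: the regression function of the
analog vector given the covariate data `x`. -/
def empRegression {𝒳 : Type*} [MeasurableSpace 𝒳] (x : ℕ → 𝒳) (y : ℕ → ℂ) (q n : ℕ) :
    Lp ℂ 2 (empMeasure x n) :=
  regression (indexMeasure n) (X := fun j : Fin n => x j) Measurable.of_discrete (analogVec y q n)

/-- The ideal target function `f_{τ,ℓ} = T_ℓ Z_τ ∈ 𝓚` for the response `g = U^τ Y`. -/
def idealTarget {Ω 𝒳 : Type*} [MeasurableSpace Ω] [MeasurableSpace 𝒳] (μ : Measure Ω)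
    {X : Ω → 𝒳} (hX : Measurable X) (𝓚 : Type*) [NormedAddCommGroup 𝓚] [InnerProductSpace ℂ 𝓚]
    [CompleteSpace 𝓚] [RKHS ℂ 𝓚 𝒳 ℂ] (lam : ℕ → ℝ) (φ : ℕ → Lp ℂ 2 (μ.map X)) (g : Ω → ℂ)
    (ℓ : ℕ) : 𝓚 :=
  target (incl 𝓚 (μ.map X)) lam φ ℓ (regression μ hX g)

/-- The empirical target function `f_{τ,ℓ,n} = T_{ℓ,n} Z_{τ,n} ∈ 𝓚ₙ`, `τ = q Δt`, for the
covariate data `x` and the response data `y`. -/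
def empTarget {𝒳 : Type*} [MeasurableSpace 𝒳] (x : ℕ → 𝒳) (y : ℕ → ℂ) (n : ℕ) (𝓚ₙ : Type*)
    [NormedAddCommGroup 𝓚ₙ] [InnerProductSpace ℂ 𝓚ₙ] [CompleteSpace 𝓚ₙ] [RKHS ℂ 𝓚ₙ 𝒳 ℂ]
    (lam : ℕ → ℝ) (φ : ℕ → Lp ℂ 2 (empMeasure x n)) (q ℓ : ℕ) : 𝓚ₙ :=
  target (incl 𝓚ₙ (empMeasure x n)) lam φ ℓ (empRegression x y q n)

end

end KAF

namespace KAF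

noncomputable section

/-! ### Expansions in orthonormal eigenvectors -/

/-! The eigenvectors `φ_{i,n}` live in a different `L²` space for each `n` and may be rotated inside
an eigenspace, so their convergence is never discussed. With `e_i = ι*φ_i`, a genuine function, the
target at `x` is the integral of `truncKernel x (X ω) = ∑_{i<ℓ} λ_i⁻² e_i(x) conj (e_i(X ω))`
against the response (`target_regression_apply`). The empirical target is the same formula with a
sample mean, so it suffices that the truncated kernels converge uniformly on `U × U` and that
weighted sample means converge uniformly in a parameter
(`Samples.tendstoUniformlyOn_sampleMean_of_tendstoUniformlyOn`).

The kernels of the powers `(ι*ι)^(m+1)` are `∑ λ_i^m e_i(x) conj (e_i(x'))`. They are iterated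
integrals of `k`, so weak convergence makes them converge uniformly. By Weierstrass approximation,
with error bounds uniform in `n`, the same holds for `∑ g(λ_i) e_i(x) conj (e_i(x'))` with any
continuous `g` (`MercerTendsto.tendsto_calcKernel`). If `g` is `t⁻²` above a spectral gap and `0`
below, this is the truncated kernel. The gap persists for large `n` because the trace `∑ g(λ_i)
λ_i²` counts the eigenvalues above it (`MercerTendsto.eventually_gap`).

For claim 3, strict positivity makes the `φ_i` an orthonormal basis, and `Z ↦ ι f_ℓ` is the
orthogonal projection onto the first `ℓ` of them. Contractions that converge pointwise converge
uniformly on compact sets, and `τ ↦ Z_τ` is continuous by dominated convergence. Claim 1 tests the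
adjoint relation for `Ξ` on indicator functions. -/

theorem _root_.Orthonormal.hasSum_inner_smul {H I : Type*} [NormedAddCommGroup H]
    [InnerProductSpace ℂ H] [CompleteSpace H] {b : I → H} (hb : Orthonormal ℂ b) {v : H}
    (hv : ∀ u, (∀ i, ⟪b i, u⟫_ℂ = 0) → ⟪u, v⟫_ℂ = 0) :
    HasSum (fun i => ⟪b i, v⟫_ℂ • b i) v := by
  obtain ⟨w, B, hsub, hB⟩ := hb.toSubtypeRange.exists_hilbertBasis_extension
  have key := B.hasSum_repr v
  let j : I → w := fun i => ⟨b i, hsub ⟨i, rfl⟩⟩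
  have hj : Function.Injective j := fun i i' h => hb.linearIndependent.injective
    (congrArg Subtype.val h)
  have hBj : ∀ i, B (j i) = b i := fun i => by rw [hB]
  rw [← hj.hasSum_iff] at key
  · convert key using 2 with i
    simp only [Function.comp_apply]
    rw [B.repr_apply_apply, hBj]
  -- A basis vector outside the given family is orthogonal to the family, hence to `v`, and
  -- contributes nothing.
  · intro y hy
    have h0 : ⟪B y, v⟫_ℂ = 0 := hv _ fun i => by
      rw [← hBj]
      exact B.orthonormal.inner_eq_zero fun h => hy ⟨i, h⟩
    rw [B.repr_apply_apply, h0, zero_smul]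

section Eigensystem

variable {𝓚 H : Type*} [NormedAddCommGroup 𝓚] [InnerProductSpace ℂ 𝓚] [CompleteSpace 𝓚]
  [NormedAddCommGroup H] [InnerProductSpace ℂ H] [CompleteSpace H]
  {ι : 𝓚 →L[ℂ] H} {lam : ℕ → ℝ} {φ : ℕ → H}

theorem IsEigensystem.hasSum_inner_smul {G : H →L[ℂ] H} (h : IsEigensystem G lam φ) {v : H}
    (hv : ∀ u, G u = 0 → ⟪u, v⟫_ℂ = 0) :
    HasSum (fun i => if 0 < lam i then ⟪φ i, v⟫_ℂ • φ i else 0) v := by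
  have key := h.orthonormal.hasSum_inner_smul (v := v) fun u hu =>
    hv u (h.complete u fun i hi => hu ⟨i, hi⟩)
  have hi : Function.Injective ((↑) : {i : ℕ // 0 < lam i} → ℕ) := Subtype.val_injective
  rw [← hi.hasSum_iff]
  · convert key using 2 with i
    simp [i.2]
  · intro i hi
    rw [if_neg]
    exact fun h => hi ⟨⟨i, h⟩, rfl⟩

/-- Since `⟪ιι*u, u⟫ = ‖ι*u‖²`, the kernel of `ιι*` is that of `ι*`, the orthogonal complement of
the range of `ι`. Hence vectors in the range have eigenvector expansions even when `G` is not
injective. -/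
theorem inner_apply_eq_zero_of_comp_adjoint_eq_zero {u : H}
    (hu : (ι ∘L ContinuousLinearMap.adjoint ι) u = 0) (f : 𝓚) : ⟪u, ι f⟫_ℂ = 0 := by
  have h0 : ContinuousLinearMap.adjoint ι u = 0 := by
    rw [← inner_self_eq_zero (𝕜 := ℂ), ContinuousLinearMap.adjoint_inner_left]
    rw [ContinuousLinearMap.comp_apply] at hu
    rw [hu, inner_zero_right]
  rw [← ContinuousLinearMap.adjoint_inner_left, h0, inner_zero_left]

theorem IsEigensystem.hasSum_inner_mul_inner
    (h : IsEigensystem (ι ∘L ContinuousLinearMap.adjoint ι) lam φ) (u : H) (f : 𝓚) :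
    HasSum (fun i => if 0 < lam i then ⟪φ i, ι f⟫_ℂ * ⟪u, φ i⟫_ℂ else 0) ⟪u, ι f⟫_ℂ := by
  have key := (innerSL ℂ u).hasSum (h.hasSum_inner_smul (v := ι f) fun u hu =>
    inner_apply_eq_zero_of_comp_adjoint_eq_zero hu f)
  refine key.congr_fun fun i => ?_
  split_ifs <;> simp

theorem IsEigensystem.apply_psi (h : IsEigensystem (ι ∘L ContinuousLinearMap.adjoint ι) lam φ)
    {i : ℕ} (hi : 0 < lam i) : ι (psi ι lam φ i) = (Real.sqrt (lam i) : ℂ) • φ i := by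
  have h1 := h.eigen i hi
  have h2 : (Real.sqrt (lam i) : ℂ) ≠ 0 := by exact_mod_cast (Real.sqrt_pos.2 hi).ne'
  have h3 : (lam i : ℂ) = (Real.sqrt (lam i) : ℂ) * (Real.sqrt (lam i) : ℂ) := by
    exact_mod_cast (Real.mul_self_sqrt hi.le).symm
  simp only [ContinuousLinearMap.comp_apply] at h1
  rw [psi, map_smul, h1, smul_smul, h3, inv_mul_cancel_left₀ h2]

theorem IsEigensystem.apply_target
    (h : IsEigensystem (ι ∘L ContinuousLinearMap.adjoint ι) lam φ) (ℓ : ℕ) (Z : H) :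
    ι (target ι lam φ ℓ Z) =
      ∑ i ∈ Finset.range ℓ, if 0 < lam i then ⟪φ i, Z⟫_ℂ • φ i else 0 := by
  rw [target, map_sum]
  refine Finset.sum_congr rfl fun i _ => ?_
  split_ifs with hi
  · have h2 : (Real.sqrt (lam i) : ℂ) ≠ 0 := by exact_mod_cast (Real.sqrt_pos.2 hi).ne'
    rw [map_smul, h.apply_psi hi, smul_smul, div_mul_cancel₀ _ h2]
  · rw [le_antisymm (not_lt.1 hi) (h.nonneg i)]
    simp

/-- `Z ↦ ι (target Z)` is an orthogonal projection, so Pythagoras applies. -/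
theorem IsEigensystem.norm_apply_target_le
    (h : IsEigensystem (ι ∘L ContinuousLinearMap.adjoint ι) lam φ) (ℓ : ℕ) (Z : H) :
    ‖ι (target ι lam φ ℓ Z)‖ ≤ ‖Z‖ := by
  have hT := h.apply_target ℓ Z
  obtain ⟨T, hTT⟩ : ∃ T, T = ι (target ι lam φ ℓ Z) := ⟨_, rfl⟩
  rw [← hTT] at hT ⊢
  have hort : ∀ i, 0 < lam i → ∀ j, 0 < lam j → ⟪φ i, φ j⟫_ℂ = if i = j then 1 else 0 := by
    intro i hi j hj
    have := orthonormal_iff_ite.1 h.orthonormal ⟨i, hi⟩ ⟨j, hj⟩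
    simpa using this
  have hperp : ⟪T, Z - T⟫_ℂ = 0 := by
    have h1 : ∀ i < ℓ, 0 < lam i → ⟪φ i, Z - T⟫_ℂ = 0 := by
      intro i hi hpos
      rw [inner_sub_right, hT, inner_sum, Finset.sum_congr rfl (g := fun j =>
        if i = j then ⟪φ j, Z⟫_ℂ else 0)]
      · simp [hi]
      · intro j _
        by_cases hj : 0 < lam j
        · rw [if_pos hj, inner_smul_right, hort i hpos j hj]
          simp
        · rw [if_neg hj, inner_zero_right, if_neg]
          rintro rfl
          exact hj hpos
    conv_lhs => rw [hT]
    rw [sum_inner]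
    refine Finset.sum_eq_zero fun i hi => ?_
    split_ifs with hpos
    · rw [inner_smul_left, ← hT, h1 i (Finset.mem_range.1 hi) hpos, mul_zero]
    · simp
  have hpyth := norm_add_sq_eq_norm_sq_add_norm_sq_of_inner_eq_zero _ _ hperp
  rw [add_sub_cancel] at hpyth
  nlinarith [norm_nonneg Z, norm_nonneg T, mul_self_nonneg ‖Z - T‖]

theorem target_sub (ℓ : ℕ) (Z W : H) :
    target ι lam φ ℓ (Z - W) = target ι lam φ ℓ Z - target ι lam φ ℓ W := by
  simp [target, sub_div, sub_smul, Finset.sum_sub_distrib]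

theorem IsEigensystem.tendsto_apply_target
    (h : IsEigensystem (ι ∘L ContinuousLinearMap.adjoint ι) lam φ)
    (hpos : ∀ f : H, f ≠ 0 → (ι ∘L ContinuousLinearMap.adjoint ι) f ≠ 0) (Z : H) :
    Tendsto (fun ℓ => ι (target ι lam φ ℓ Z)) atTop (𝓝 Z) := by
  simp only [h.apply_target]
  refine (h.hasSum_inner_smul fun u hu => ?_).tendsto_sum_nat
  rw [not_imp_not.1 (hpos u) hu, inner_zero_left]

/-- The maps `Z ↦ ι (target Z)` are 1-Lipschitz uniformly in `ℓ`, so pointwise convergence at `Z τ₀`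
spreads to a neighbourhood of `τ₀` by an `ε/3` argument. -/
theorem IsEigensystem.tendstoUniformlyOn_apply_target
    (h : IsEigensystem (ι ∘L ContinuousLinearMap.adjoint ι) lam φ)
    (hpos : ∀ f : H, f ≠ 0 → (ι ∘L ContinuousLinearMap.adjoint ι) f ≠ 0)
    {P : Type*} [TopologicalSpace P] {T : Set P} (hT : IsCompact T) {Z : P → H}
    (hZ : Continuous Z) :
    TendstoUniformlyOn (fun ℓ τ => ι (target ι lam φ ℓ (Z τ))) Z atTop T := by
  rw [← tendstoLocallyUniformlyOn_iff_tendstoUniformlyOn_of_compact hT,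
    Metric.tendstoLocallyUniformlyOn_iff]
  intro ε hε τ₀ _
  refine ⟨Z ⁻¹' Metric.ball (Z τ₀) (ε / 3), mem_nhdsWithin_of_mem_nhds
    (hZ.continuousAt.preimage_mem_nhds (Metric.ball_mem_nhds _ (by positivity))), ?_⟩
  filter_upwards [Metric.tendsto_nhds.1 (h.tendsto_apply_target hpos (Z τ₀)) (ε / 3)
    (by positivity)] with ℓ hℓ τ hτ
  have h1 : dist (Z τ) (Z τ₀) < ε / 3 := hτ
  have h2 : dist (ι (target ι lam φ ℓ (Z τ₀))) (ι (target ι lam φ ℓ (Z τ))) ≤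
      dist (Z τ₀) (Z τ) := by
    rw [dist_eq_norm, dist_eq_norm, ← map_sub, ← target_sub]
    exact h.norm_apply_target_le _ _
  rw [dist_comm] at hℓ h2
  rw [dist_comm (Z τ₀)] at h2
  have h3 := dist_triangle4 (Z τ) (Z τ₀) (ι (target ι lam φ ℓ (Z τ₀)))
    (ι (target ι lam φ ℓ (Z τ)))
  rw [dist_comm (ι (target ι lam φ ℓ (Z τ₀)))] at h3
  linarith

/-- `ι* φ_i` for the eigenvectors with positive eigenvalue, and `0` for the remaining indices. -/
def eigFun (ι : 𝓚 →L[ℂ] H) (lam : ℕ → ℝ) (φ : ℕ → H) (i : ℕ) : 𝓚 :=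
  if 0 < lam i then ContinuousLinearMap.adjoint ι (φ i) else 0

theorem IsEigensystem.norm_apply_eigFun
    (h : IsEigensystem (ι ∘L ContinuousLinearMap.adjoint ι) lam φ) (i : ℕ) :
    ‖ι (eigFun ι lam φ i)‖ = lam i := by
  by_cases hi : 0 < lam i
  · have h1 := h.eigen i hi
    rw [ContinuousLinearMap.comp_apply] at h1
    have h2 : ‖φ i‖ = 1 := h.orthonormal.1 ⟨i, hi⟩
    rw [eigFun, if_pos hi, h1, norm_smul, h2]
    simp [abs_of_pos hi]
  · rw [eigFun, if_neg hi, map_zero, norm_zero]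
    exact le_antisymm (h.nonneg i) (not_lt.1 hi)

theorem IsEigensystem.apply_eigFun
    (h : IsEigensystem (ι ∘L ContinuousLinearMap.adjoint ι) lam φ) {i : ℕ} (hi : 0 < lam i) :
    ι (eigFun ι lam φ i) = (lam i : ℂ) • φ i := by
  rw [eigFun, if_pos hi]
  exact h.eigen i hi

theorem IsEigensystem.inner_apply_pow
    (h : IsEigensystem (ι ∘L ContinuousLinearMap.adjoint ι) lam φ) {i : ℕ} (hi : 0 < lam i)
    (m : ℕ) (f : 𝓚) :
    ⟪φ i, ι (((ContinuousLinearMap.adjoint ι ∘L ι) ^ m) f)⟫_ℂ = (lam i : ℂ) ^ m * ⟪φ i, ι f⟫_ℂ := by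
  induction m generalizing f with
  | zero => simp
  | succ m ih =>
    rw [pow_succ, mul_apply_eq_comp, ih, ContinuousLinearMap.comp_apply]
    have h1 := h.eigen i hi
    rw [ContinuousLinearMap.comp_apply] at h1
    have h2 : ⟪φ i, ι (ContinuousLinearMap.adjoint ι (ι f))⟫_ℂ = (lam i : ℂ) * ⟪φ i, ι f⟫_ℂ := by
      rw [← ContinuousLinearMap.adjoint_inner_left, ← ContinuousLinearMap.adjoint_inner_left,
        ContinuousLinearMap.adjoint_adjoint, h1, inner_smul_left]
      simp
    rw [h2]
    ring

/-- Two factors `λ_i^(-1/2)` combine to `λ_i⁻¹`, and `φ_i = λ_i⁻¹ ι (ι*φ_i)` supplies the other. The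
target is thereby expressed through the RKHS elements `ι*φ_i` alone. -/
theorem IsEigensystem.target_eq
    (h : IsEigensystem (ι ∘L ContinuousLinearMap.adjoint ι) lam φ) {ℓ : ℕ}
    (hℓ : ∀ i < ℓ, 0 < lam i) (Z : H) :
    target ι lam φ ℓ Z = ∑ i ∈ Finset.range ℓ,
      ((lam i : ℂ)⁻¹ ^ 2 * ⟪ι (eigFun ι lam φ i), Z⟫_ℂ) • eigFun ι lam φ i := by
  refine Finset.sum_congr rfl fun i hi => ?_
  have hi := hℓ i (Finset.mem_range.1 hi)
  have h2 : (Real.sqrt (lam i) : ℂ) ≠ 0 := by exact_mod_cast (Real.sqrt_pos.2 hi).ne'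
  have h3 : (lam i : ℂ) = (Real.sqrt (lam i) : ℂ) * (Real.sqrt (lam i) : ℂ) := by
    exact_mod_cast (Real.mul_self_sqrt hi.le).symm
  rw [h.apply_eigFun hi, eigFun, if_pos hi, psi, smul_smul, inner_smul_left, Complex.conj_ofReal,
    h3]
  congr 1
  field_simp

end Eigensystem

/-! ### Powers of the kernel and Mercer expansions -/

section Kernel

variable {𝒳 : Type*} {𝓚 : Type*} [NormedAddCommGroup 𝓚] [InnerProductSpace ℂ 𝓚]
  [CompleteSpace 𝓚] [RKHS ℂ 𝓚 𝒳 ℂ]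

theorem inner_kerFun_one (x : 𝒳) (f : 𝓚) : ⟪RKHS.kerFun 𝓚 x (1 : ℂ), f⟫_ℂ = f x := by
  rw [RKHS.kerFun_inner]
  simp

theorem continuous_kerFun_one [TopologicalSpace 𝒳]
    (hk : Continuous fun p : 𝒳 × 𝒳 => scalarKernel 𝓚 p.1 p.2) :
    Continuous fun x : 𝒳 => RKHS.kerFun 𝓚 x (1 : ℂ) := by
  rw [continuous_iff_continuousAt]
  intro x
  rw [ContinuousAt, tendsto_iff_norm_sub_tendsto_zero]
  have h1 : ∀ y, ‖RKHS.kerFun 𝓚 y (1 : ℂ) - RKHS.kerFun 𝓚 x (1 : ℂ)‖ =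
      Real.sqrt (scalarKernel 𝓚 y y - scalarKernel 𝓚 y x
        - scalarKernel 𝓚 x y + scalarKernel 𝓚 x x).re := by
    intro y
    simp only [← inner_kerFun_eq_scalarKernel]
    rw [← inner_sub_sub_self, norm_eq_sqrt_re_inner (𝕜 := ℂ)]
    rfl
  have h2 : Continuous fun y => Real.sqrt (scalarKernel 𝓚 y y - scalarKernel 𝓚 y x
      - scalarKernel 𝓚 x y + scalarKernel 𝓚 x x).re := by
    have a1 := hk.comp (continuous_id.prodMk continuous_id)
    have a2 := hk.comp (continuous_id.prodMk (continuous_const (y := x)))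
    have a3 := hk.comp ((continuous_const (y := x)).prodMk continuous_id)
    simp only [Function.comp_def, id] at a1 a2 a3
    exact Real.continuous_sqrt.comp
      (Complex.continuous_re.comp (((a1.sub a2).sub a3).add continuous_const))
  have h3 := h2.tendsto x
  rw [← h1 x, sub_self, norm_zero] at h3
  exact h3.congr fun y => (h1 y).symm

theorem eigFun_apply {H : Type*} [NormedAddCommGroup H] [InnerProductSpace ℂ H] [CompleteSpace H]
    (ι : 𝓚 →L[ℂ] H) (lam : ℕ → ℝ) (φ : ℕ → H) (i : ℕ) (x : 𝒳) :
    eigFun ι lam φ i x = if 0 < lam i then ⟪ι (RKHS.kerFun 𝓚 x (1 : ℂ)), φ i⟫_ℂ else 0 := by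
  rw [eigFun, ← inner_kerFun_one]
  split_ifs
  · rw [ContinuousLinearMap.adjoint_inner_right]
  · rw [inner_zero_right]

theorem coeFn_finsetSum_smul {α : Type*} (s : Finset α) (c : α → ℂ) (f : α → 𝓚) (x : 𝒳) :
    (∑ i ∈ s, c i • f i) x = ∑ i ∈ s, c i * f i x := by
  simp only [← inner_kerFun_one, inner_sum, inner_smul_right]

/-- The kernel of the spectrally truncated inverse of the integral operator. -/
def truncKernel (lam : ℕ → ℝ) (e : ℕ → 𝒳 → ℂ) (ℓ : ℕ) (x x' : 𝒳) : ℂ :=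
  ∑ i ∈ Finset.range ℓ, (lam i : ℂ)⁻¹ ^ 2 * (e i x * (starRingEnd ℂ) (e i x'))

variable [MeasurableSpace 𝒳]

/-- The kernel of the `m`-th power of the integral operator on `𝓚`:
`kerPow 𝓚 ρ m x x' = ⟨k_x, (ι* ι)^m k_x'⟩`. -/
def kerPow (𝓚 : Type*) [NormedAddCommGroup 𝓚] [InnerProductSpace ℂ 𝓚] [CompleteSpace 𝓚]
    [RKHS ℂ 𝓚 𝒳 ℂ] (ρ : Measure 𝒳) (m : ℕ) (x x' : 𝒳) : ℂ :=
  ((ContinuousLinearMap.adjoint (incl 𝓚 ρ) ∘L incl 𝓚 ρ) ^ m) (RKHS.kerFun 𝓚 x' (1 : ℂ)) x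

theorem kerPow_zero (ρ : Measure 𝒳) (x x' : 𝒳) : kerPow 𝓚 ρ 0 x x' = scalarKernel 𝓚 x x' := by
  rw [kerPow, scalarKernel, pow_zero, one_apply_eq_self, RKHS.kerFun_apply]

theorem continuous_kerPow [TopologicalSpace 𝒳] (ρ : Measure 𝒳)
    (hk : Continuous fun p : 𝒳 × 𝒳 => scalarKernel 𝓚 p.1 p.2) (m : ℕ) :
    Continuous fun p : 𝒳 × 𝒳 => kerPow 𝓚 ρ m p.1 p.2 := by
  have hc := continuous_kerFun_one hk
  simp only [kerPow, ← inner_kerFun_one]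
  exact (hc.comp continuous_fst).inner
    ((ContinuousLinearMap.continuous _).comp (hc.comp continuous_snd))

variable {ρ : Measure 𝒳}

theorem inner_incl_incl (h : ∀ f : 𝓚, MemLp (⇑f) 2 ρ) (f g : 𝓚) :
    ⟪incl 𝓚 ρ f, incl 𝓚 ρ g⟫_ℂ = ∫ x, g x * (starRingEnd ℂ) (f x) ∂ρ := by
  rw [L2.inner_def]
  refine integral_congr_ae ?_
  filter_upwards [coeFn_incl h f, coeFn_incl h g] with x hx hx'
  rw [hx, hx']
  rfl

/-- Peeling off one factor `ι*ι` gives an integral against `k`. This recursion carries uniform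
convergence from one power to the next. -/
theorem kerPow_succ (h : ∀ f : 𝓚, MemLp (⇑f) 2 ρ) (m : ℕ) (x x' : 𝒳) :
    kerPow 𝓚 ρ (m + 1) x x' = ∫ y, scalarKernel 𝓚 x y * kerPow 𝓚 ρ m y x' ∂ρ := by
  rw [kerPow, pow_succ', mul_apply_eq_comp, ContinuousLinearMap.comp_apply, ← inner_kerFun_one,
    ContinuousLinearMap.adjoint_inner_right, inner_incl_incl h]
  refine integral_congr_ae (Eventually.of_forall fun y => ?_)
  simp only
  rw [mul_comm, ← inner_kerFun_one y (RKHS.kerFun 𝓚 x (1 : ℂ)), inner_conj_symm,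
    inner_kerFun_eq_scalarKernel, kerPow]

/-- Functions `e i` and numbers `lam i` such that `K m x x' = ∑ i, lam i ^ m * e i x * conj (e i x')`
for all `m`, where `‖e i‖ = lam i` in `L²(ρ)`. -/
structure MercerSystem (ρ : Measure 𝒳) (lam : ℕ → ℝ) (e : ℕ → 𝒳 → ℂ) (K : ℕ → 𝒳 → 𝒳 → ℂ) :
    Prop where
  antitone : Antitone lam
  nonneg : ∀ i, 0 ≤ lam i
  integrable : ∀ i, Integrable (fun x => e i x * (starRingEnd ℂ) (e i x)) ρ
  integral_sq : ∀ i, ∫ x, e i x * (starRingEnd ℂ) (e i x) ∂ρ = (lam i : ℂ) ^ 2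
  hasSum : ∀ m x x', HasSum (fun i => (lam i : ℂ) ^ m * (e i x * (starRingEnd ℂ) (e i x')))
    (K m x x')

/-- Writing one factor `ι*ι` as an inner product in `L²(ρ)` turns the expansion into Parseval's
identity there. Hence the shift to `m + 1`: the kernel `k` itself may have a part in the kernel of
`ι` that no eigenfunction sees. -/
theorem IsEigensystem.mercerSystem {lam : ℕ → ℝ} {φ : ℕ → Lp ℂ 2 ρ}
    (hE : IsEigensystem (kernelOp 𝓚 ρ) lam φ) (h : ∀ f : 𝓚, MemLp (⇑f) 2 ρ) :
    MercerSystem ρ lam (fun i => ⇑(eigFun (incl 𝓚 ρ) lam φ i))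
      (fun m => kerPow 𝓚 ρ (m + 1)) where
  antitone := hE.antitone
  nonneg := hE.nonneg
  integrable i := (h _).integrable_mul (h _).star
  integral_sq i := by
    rw [← inner_incl_incl h, inner_self_eq_norm_sq_to_K]
    exact congrArg (fun t : ℝ => (t : ℂ) ^ 2) (IsEigensystem.norm_apply_eigFun hE i)
  hasSum m x x' := by
    rw [kerPow, pow_succ', mul_apply_eq_comp, ContinuousLinearMap.comp_apply, ← inner_kerFun_one,
      ContinuousLinearMap.adjoint_inner_right]
    convert IsEigensystem.hasSum_inner_mul_inner hE _ _ using 2 with i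
    simp only [eigFun_apply]
    split_ifs with hi
    · rw [IsEigensystem.inner_apply_pow hE hi, inner_conj_symm]
      ring
    · simp

theorem inner_incl_regression {S : Type*} [MeasurableSpace S] {μ : Measure S} {X : S → 𝒳}
    (hX : Measurable X) (h : ∀ f : 𝓚, MemLp (⇑f) 2 (μ.map X)) {g : S → ℂ} (hg : MemLp g 2 μ)
    (f : 𝓚) :
    ⟪incl 𝓚 (μ.map X) f, regression μ hX g⟫_ℂ = ∫ s, (starRingEnd ℂ) (f (X s)) * g s ∂μ := by
  rw [regression, ContinuousLinearMap.adjoint_inner_right, L2.inner_def, toL2, dif_pos hg]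
  refine integral_congr_ae ?_
  have h1 : (pullback μ hX (incl 𝓚 (μ.map X) f) : S → ℂ) =ᵐ[μ] incl 𝓚 (μ.map X) f ∘ X :=
    Lp.coeFn_compMeasurePreserving _ (hX.measurePreserving μ)
  filter_upwards [h1, (hX.measurePreserving μ).quasiMeasurePreserving.ae (coeFn_incl h f),
    hg.coeFn_toLp] with s h1 h2 h3
  rw [h1, h3, Function.comp_apply, h2, mul_comm]
  rfl

/-- One formula for both targets: `μ` gives the ideal one, and the uniform measure on sample indices
gives the empirical one as a sample mean. -/
theorem target_regression_apply {S : Type*} [MeasurableSpace S] {μ : Measure S} {X : S → 𝒳}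
    (hX : Measurable X) (h : ∀ f : 𝓚, MemLp (⇑f) 2 (μ.map X)) {g : S → ℂ} (hg : MemLp g 2 μ)
    {lam : ℕ → ℝ} {φ : ℕ → Lp ℂ 2 (μ.map X)} (hE : IsEigensystem (kernelOp 𝓚 (μ.map X)) lam φ)
    {ℓ : ℕ} (hℓ : ∀ i < ℓ, 0 < lam i) (x : 𝒳) :
    target (incl 𝓚 (μ.map X)) lam φ ℓ (regression μ hX g) x =
      ∫ s, truncKernel lam (fun i => ⇑(eigFun (incl 𝓚 (μ.map X)) lam φ i)) ℓ x (X s) * g s ∂μ := by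
  rw [IsEigensystem.target_eq hE hℓ, coeFn_finsetSum_smul]
  simp only [truncKernel, Finset.sum_mul]
  rw [integral_finsetSum]
  · refine Finset.sum_congr rfl fun i _ => ?_
    rw [inner_incl_regression hX h hg, mul_assoc, mul_comm (integral _ _), ← integral_const_mul,
      ← integral_const_mul]
    refine integral_congr_ae (Eventually.of_forall fun s => ?_)
    simp only
    ring
  · intro i _
    have h1 : MemLp (fun s => (starRingEnd ℂ) (eigFun (incl 𝓚 (μ.map X)) lam φ i (X s))) 2 μ :=
      ((h _).comp_measurePreserving (hX.measurePreserving μ)).star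
    have h2 : Integrable (fun s => (starRingEnd ℂ) (eigFun (incl 𝓚 (μ.map X)) lam φ i (X s)) *
      g s) μ := h1.integrable_mul hg
    refine (h2.const_mul ((lam i : ℂ)⁻¹ ^ 2 * eigFun (incl 𝓚 (μ.map X)) lam φ i x)).congr
      (Eventually.of_forall fun s => ?_)
    simp only
    ring

end Kernel

/-! ### Sample means and uniform convergence of weighted sample means -/

theorem _root_.TendstoUniformlyOn.mul_of_bounded {P : Type*} {F G : ℕ → P → ℂ} {f g : P → ℂ}
    {s : Set P} (hF : TendstoUniformlyOn F f atTop s) (hG : TendstoUniformlyOn G g atTop s)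
    (hf : ∃ C, ∀ p ∈ s, ‖f p‖ ≤ C) (hg : ∃ C, ∀ p ∈ s, ‖g p‖ ≤ C) :
    TendstoUniformlyOn (fun n p => F n p * G n p) (fun p => f p * g p) atTop s := by
  obtain ⟨A, hA⟩ := hf
  obtain ⟨B, hB⟩ := hg
  rw [Metric.tendstoUniformlyOn_iff] at *
  intro ε hε
  -- `δ ≤ 1` bounds `G n p` by `|B| + 1`. The total error is then `δ (|A| + |B| + 1)`, strictly
  -- below `ε` because of the `2`.
  set δ := min 1 (ε / (|A| + |B| + 2)) with hδ
  have hδ0 : 0 < δ := by positivity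
  have hδ1 : δ ≤ 1 := min_le_left _ _
  have hδ2 : δ * (|A| + |B| + 2) ≤ ε := by
    rw [← le_div_iff₀ (by positivity)]
    exact min_le_right _ _
  filter_upwards [hF δ hδ0, hG δ hδ0] with n h1 h2 p hp
  have h1 := h1 p hp
  have h2 := h2 p hp
  rw [dist_eq_norm] at h1 h2 ⊢
  have ha := (hA p hp).trans (le_abs_self A)
  have hb := (hB p hp).trans (le_abs_self B)
  have hGn : ‖G n p‖ ≤ |B| + 1 := by
    have := norm_sub_norm_le (G n p) (g p)
    rw [norm_sub_rev] at this
    linarith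
  have key : f p * g p - F n p * G n p = (f p - F n p) * G n p + f p * (g p - G n p) := by ring
  calc ‖f p * g p - F n p * G n p‖ ≤ ‖f p - F n p‖ * ‖G n p‖ + ‖f p‖ * ‖g p - G n p‖ := by
        rw [key]
        exact (norm_add_le _ _).trans (by rw [norm_mul, norm_mul])
    _ ≤ δ * (|B| + 1) + |A| * δ := by gcongr
    _ < ε := by nlinarith

/-- The mean of the first `n` terms of a sequence. -/
def sampleMean (n : ℕ) (a : ℕ → ℂ) : ℂ := (n : ℂ)⁻¹ * ∑ j ∈ Finset.range n, a j

theorem sampleMean_sub (n : ℕ) (a b : ℕ → ℂ) :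
    sampleMean n a - sampleMean n b = sampleMean n fun j => a j - b j := by
  simp only [sampleMean, Finset.sum_sub_distrib, mul_sub]

theorem norm_sampleMean_le_mean (n : ℕ) {a : ℕ → ℂ} {b : ℕ → ℝ} (h : ∀ j < n, ‖a j‖ ≤ b j) :
    ‖sampleMean n a‖ ≤ (n : ℝ)⁻¹ * ∑ j ∈ Finset.range n, b j := by
  rw [sampleMean, norm_mul, norm_inv, Complex.norm_natCast]
  gcongr
  exact norm_sum_le_of_le _ fun j hj => h j (Finset.mem_range.1 hj)

theorem norm_sampleMean_le (n : ℕ) {a : ℕ → ℂ} {C : ℝ} (hC : 0 ≤ C) (h : ∀ j < n, ‖a j‖ ≤ C) :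
    ‖sampleMean n a‖ ≤ C := by
  refine (norm_sampleMean_le_mean n h).trans ?_
  rw [Finset.sum_const, Finset.card_range, nsmul_eq_mul, ← mul_assoc]
  rcases eq_or_ne n 0 with rfl | hn
  · simpa using hC
  · rw [inv_mul_cancel₀ (by exact_mod_cast hn), one_mul]

theorem integral_empMeasure {S : Type*} [MeasurableSpace S] [MeasurableSingletonClass S]
    (p : ℕ → S) (n : ℕ) (g : S → ℂ) :
    ∫ s, g s ∂(empMeasure p n) = sampleMean n fun j => g (p j) := by
  rw [empMeasure_eq_sum_dirac, integral_smul_measure, integral_finsetSum_measure]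
  · simp [sampleMean]
  · exact fun i _ => integrable_dirac (by simp)

theorem integral_indexMeasure (n : ℕ) (g : ℕ → ℂ) :
    ∫ j : Fin n, g j ∂(indexMeasure n) = sampleMean n g := by
  rw [indexMeasure, integral_smul_measure, integral_count, sampleMean,
    ← Fin.sum_univ_eq_sum_range]
  simp

instance isFiniteMeasure_indexMeasure (n : ℕ) : IsFiniteMeasure (indexMeasure n) := by
  rcases eq_or_ne n 0 with rfl | hn
  · rw [Measure.eq_zero_of_isEmpty (indexMeasure 0)]
    infer_instance
  · refine ⟨?_⟩
    rw [indexMeasure, Measure.smul_apply, smul_eq_mul]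
    exact ENNReal.mul_lt_top (ENNReal.inv_lt_top.2 (by simpa using Nat.pos_of_ne_zero hn))
      (measure_lt_top _ _)

instance isFiniteMeasure_empMeasure {S : Type*} [MeasurableSpace S] (p : ℕ → S) (n : ℕ) :
    IsFiniteMeasure (empMeasure p n) := by
  rw [empMeasure]
  infer_instance

/-- Only an inequality: for `n = 0` the empirical measure is zero. -/
theorem empMeasure_univ_le_one {S : Type*} [MeasurableSpace S] (p : ℕ → S) (n : ℕ) :
    empMeasure p n univ ≤ 1 := by
  rw [empMeasure_eq_sum_dirac]
  simp [ENNReal.inv_mul_le_one]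

theorem ae_empMeasure_mem {S : Type*} [MeasurableSpace S] {p : ℕ → S} {n : ℕ} {V : Set S}
    (hV : MeasurableSet V) (hp : ∀ j, p j ∈ V) : ∀ᵐ s ∂(empMeasure p n), s ∈ V := by
  rw [empMeasure]
  exact (ae_map_iff Measurable.of_discrete.aemeasurable hV).2 (Eventually.of_forall fun j => hp j)

/-- The sequence `p` in `V` samples the measure `μ`, carried by `V`: the sample means of all
continuous functions which are bounded on `V` converge to the `μ`-integral. -/
structure Samples {Ω : Type*} [TopologicalSpace Ω] [MeasurableSpace Ω] (p : ℕ → Ω)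
    (μ : Measure Ω) (V : Set Ω) : Prop where
  mem : ∀ j, p j ∈ V
  ae_mem : ∀ᵐ ω ∂μ, ω ∈ V
  tendsto : ∀ g : Ω → ℂ, Continuous g → (∃ C, ∀ ω ∈ V, ‖g ω‖ ≤ C) →
    Tendsto (fun n => sampleMean n fun j => g (p j)) atTop (𝓝 (∫ ω, g ω ∂μ))

section Samples

variable {Ω : Type*} [TopologicalSpace Ω] [MeasurableSpace Ω]
  {p : ℕ → Ω} {μ : Measure Ω} {V : Set Ω}

theorem samples_of_tendsto_integral [MeasurableSingletonClass Ω]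
    (hweak : ∀ g : BoundedContinuousFunction Ω ℂ,
      Tendsto (fun n => ∫ ω, g ω ∂(empMeasure p n)) atTop (𝓝 (∫ ω, g ω ∂μ)))
    (hp : ∀ j, p j ∈ V) (hV : ∀ᵐ ω ∂μ, ω ∈ V) : Samples p μ V where
  mem := hp
  ae_mem := hV
  tendsto := by
    rintro g hg ⟨C, hC⟩
    have hpos : ∀ ω, 0 < max (|C| + 1) ‖g ω‖ := fun ω => lt_max_of_lt_left (by positivity)
    -- Weak convergence admits bounded test functions only. Radial truncation at height `|C| + 1`
    -- keeps continuity and does not change `g` on `V`, which carries all the sample points and `μ`.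
    let c : Ω → ℂ := fun ω => (((|C| + 1) / max (|C| + 1) ‖g ω‖ : ℝ) : ℂ) * g ω
    have hc : Continuous c := (Complex.continuous_ofReal.comp
      (continuous_const.div (continuous_const.max hg.norm) fun ω => (hpos ω).ne')).mul hg
    have hcb : ∀ ω, ‖c ω‖ ≤ |C| + 1 := by
      intro ω
      rw [norm_mul, Complex.norm_real, Real.norm_of_nonneg (by positivity), div_mul_eq_mul_div,
        div_le_iff₀ (hpos ω)]
      gcongr
      exact le_max_right _ _
    have hcV : ∀ ω ∈ V, c ω = g ω := by
      intro ω hω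
      have h1 : ‖g ω‖ ≤ |C| + 1 := by linarith [hC ω hω, le_abs_self C]
      have h2 : |C| + 1 ≠ 0 := by positivity
      simp only [c]
      rw [max_eq_left h1, div_self h2, Complex.ofReal_one, one_mul]
    have key := hweak (BoundedContinuousFunction.ofNormedAddCommGroup c hc _ hcb)
    simp only [BoundedContinuousFunction.coe_ofNormedAddCommGroup, integral_empMeasure] at key
    rw [integral_congr_ae (g := g) (by filter_upwards [hV] with ω hω using hcV ω hω)] at key
    refine key.congr fun n => ?_
    simp only [hcV _ (hp _)]

variable [OpensMeasurableSpace Ω] [IsProbabilityMeasure μ] {𝒳 : Type*} [TopologicalSpace 𝒳] {X : Ω → 𝒳} {U : Set 𝒳}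
  {P : Type*} [TopologicalSpace P] {T : Set P} {w : Ω → ℂ}

/-- Compactness of `U` makes `F t` close to `F t₀` uniformly on `U` for `t` near `t₀`, so sample
means and integrals are equicontinuous in `t`, uniformly in `n`. Convergence at `t₀` is then locally
uniform. -/
theorem Samples.tendstoUniformlyOn_sampleMean (hS : Samples p μ (X ⁻¹' U)) (hX : Continuous X)
    (hU : IsCompact U) (hT : IsCompact T) {F : P → 𝒳 → ℂ} (hF : Continuous F.uncurry)
    (hw : Continuous w) (hwb : ∃ C, ∀ ω, X ω ∈ U → ‖w ω‖ ≤ C) :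
    TendstoUniformlyOn (fun n t => sampleMean n fun j => F t (X (p j)) * w (p j))
      (fun t => ∫ ω, F t (X ω) * w ω ∂μ) atTop T := by
  obtain ⟨C, hC⟩ := hwb
  have hFt : ∀ t, Continuous fun ω => F t (X ω) * w ω := fun t =>
    (hF.comp (continuous_const.prodMk hX)).mul hw
  have hb : ∀ t, ∃ B, ∀ ω ∈ X ⁻¹' U, ‖F t (X ω) * w ω‖ ≤ B := by
    intro t
    obtain ⟨B, hB⟩ := hU.exists_bound_of_continuousOn
      (hF.comp (continuous_const (y := t).prodMk continuous_id)).continuousOn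
    refine ⟨B * |C|, fun ω hω => ?_⟩
    rw [norm_mul]
    have h1 : ‖F t (X ω)‖ ≤ B := hB _ hω
    have h2 := (hC ω hω).trans (le_abs_self C)
    have h3 := (norm_nonneg _).trans h1
    gcongr
  have hint : ∀ t, Integrable (fun ω => F t (X ω) * w ω) μ := by
    intro t
    obtain ⟨B, hB⟩ := hb t
    refine Integrable.of_bound (hFt t).aestronglyMeasurable B ?_
    filter_upwards [hS.ae_mem] with ω hω using hB ω hω
  rw [← tendstoLocallyUniformlyOn_iff_tendstoUniformlyOn_of_compact hT,
    Metric.tendstoLocallyUniformlyOn_iff]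
  intro ε hε t₀ ht₀
  set δ := ε / (3 * (|C| + 1)) with hδ
  have hδ0 : 0 < δ := by positivity
  have hδC : δ * |C| ≤ ε / 3 := by
    rw [hδ, div_mul_eq_mul_div, div_le_div_iff₀ (by positivity) (by positivity)]
    nlinarith [abs_nonneg C]
  obtain ⟨v, hv, hvF⟩ := hU.mem_uniformity_of_prod (f := F) (s := T) hF.continuousOn ht₀
    (Metric.dist_mem_uniformity hδ0)
  have hpt : ∀ t ∈ v, ∀ ω ∈ X ⁻¹' U, ‖F t (X ω) * w ω - F t₀ (X ω) * w ω‖ ≤ ε / 3 := by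
    intro t ht ω hω
    rw [← sub_mul, norm_mul, ← dist_eq_norm]
    have h1 : dist (F t (X ω)) (F t₀ (X ω)) < δ := hvF t ht _ hω
    exact (mul_le_mul h1.le ((hC ω hω).trans (le_abs_self C)) (norm_nonneg _) hδ0.le).trans hδC
  refine ⟨v, hv, ?_⟩
  filter_upwards [Metric.tendsto_nhds.1 (hS.tendsto _ (hFt t₀) (hb t₀)) (ε / 3) (by positivity)]
    with n hn t ht
  have h1 : dist (∫ ω, F t (X ω) * w ω ∂μ) (∫ ω, F t₀ (X ω) * w ω ∂μ) ≤ ε / 3 := by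
    rw [dist_eq_norm, ← integral_sub (hint t) (hint t₀)]
    refine (norm_integral_le_of_norm_le_const (C := ε / 3) ?_).trans (by simp)
    filter_upwards [hS.ae_mem] with ω hω using hpt t ht ω hω
  have h2 : dist (sampleMean n fun j => F t (X (p j)) * w (p j))
      (sampleMean n fun j => F t₀ (X (p j)) * w (p j)) ≤ ε / 3 := by
    rw [dist_eq_norm, sampleMean_sub]
    exact norm_sampleMean_le n (by positivity) fun j _ => hpt t ht _ (hS.mem j)
  have h3 := dist_triangle4 (∫ ω, F t (X ω) * w ω ∂μ) (∫ ω, F t₀ (X ω) * w ω ∂μ)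
    (sampleMean n fun j => F t₀ (X (p j)) * w (p j))
    (sampleMean n fun j => F t (X (p j)) * w (p j))
  rw [dist_comm] at hn h2
  linarith

/-- The integrands may vary uniformly with `n`, but the weights only in mean: an analog vector is
wrong in its last entries by an amount that does not become small. -/
theorem Samples.tendstoUniformlyOn_sampleMean_of_tendstoUniformlyOn
    (hS : Samples p μ (X ⁻¹' U)) (hX : Continuous X)
    (hU : IsCompact U) (hT : IsCompact T) {F : P → 𝒳 → ℂ} (hF : Continuous F.uncurry)
    (hw : Continuous w) (hwb : ∃ C, ∀ ω, X ω ∈ U → ‖w ω‖ ≤ C) {Fn : ℕ → P → 𝒳 → ℂ}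
    (hFn : TendstoUniformlyOn (fun n => (Fn n).uncurry) F.uncurry atTop (T ×ˢ U))
    {wn : ℕ → ℕ → ℂ} (hwn : ∃ C, ∀ n j, ‖wn n j‖ ≤ C)
    (hwnw : Tendsto (fun n : ℕ => (n : ℝ)⁻¹ * ∑ j ∈ Finset.range n, ‖wn n j - w (p j)‖)
      atTop (𝓝 0)) :
    TendstoUniformlyOn (fun n t => sampleMean n fun j => Fn n t (X (p j)) * wn n j)
      (fun t => ∫ ω, F t (X ω) * w ω ∂μ) atTop T := by
  have key := hS.tendstoUniformlyOn_sampleMean hX hU hT hF hw hwb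
  obtain ⟨C, hC⟩ := hwn
  obtain ⟨B, hB⟩ := (hT.prod hU).exists_bound_of_continuousOn hF.continuousOn
  rw [Metric.tendstoUniformlyOn_iff] at key hFn ⊢
  intro ε hε
  set δ := ε / (3 * (|C| + |B| + 1)) with hδ
  have hδ0 : 0 < δ := by positivity
  have hδC : δ * |C| + |B| * δ ≤ ε / 3 := by
    have : δ * (|C| + |B| + 1) = ε / 3 := by
      rw [hδ]
      field_simp
    nlinarith
  filter_upwards [key (ε / 3) (by positivity), hFn δ hδ0,
    (tendsto_order.1 hwnw).2 δ hδ0] with n h1 h2 h3 t ht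
  have h4 : ‖(sampleMean n fun j => F t (X (p j)) * w (p j)) -
      sampleMean n fun j => Fn n t (X (p j)) * wn n j‖ ≤ ε / 3 := by
    rw [sampleMean_sub]
    refine (norm_sampleMean_le_mean n (b := fun j => δ * |C| + |B| * ‖wn n j - w (p j)‖)
      fun j _ => ?_).trans ?_
    · have h5 : dist (F t (X (p j))) (Fn n t (X (p j))) < δ := h2 (t, X (p j)) ⟨ht, hS.mem j⟩
      have h6 : ‖F t (X (p j))‖ ≤ B := hB (t, X (p j)) ⟨ht, hS.mem j⟩
      rw [dist_eq_norm] at h5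
      have h7 : F t (X (p j)) * w (p j) - Fn n t (X (p j)) * wn n j =
        (F t (X (p j)) - Fn n t (X (p j))) * wn n j - F t (X (p j)) * (wn n j - w (p j)) := by
        ring
      rw [h7]
      refine (norm_sub_le _ _).trans ?_
      rw [norm_mul, norm_mul]
      have := (hC n j).trans (le_abs_self C)
      have := h6.trans (le_abs_self B)
      gcongr
    · rw [Finset.sum_add_distrib, Finset.sum_const, Finset.card_range, nsmul_eq_mul, mul_add,
        ← Finset.mul_sum, mul_left_comm _ |B|]
      have h8 : (n : ℝ)⁻¹ * (n * (δ * |C|)) ≤ δ * |C| := by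
        rcases eq_or_ne n 0 with rfl | hn
        · simp only [Nat.cast_zero, zero_mul, mul_zero]
          positivity
        · rw [inv_mul_cancel_left₀ (by exact_mod_cast hn)]
      have h9 := mul_le_mul_of_nonneg_left h3.le (abs_nonneg B)
      linarith
  have h5 := h1 t ht
  have h6 := dist_triangle (∫ ω, F t (X ω) * w ω ∂μ)
    (sampleMean n fun j => F t (X (p j)) * w (p j))
    (sampleMean n fun j => Fn n t (X (p j)) * wn n j)
  rw [← dist_eq_norm] at h4
  linarith

end Samples

/-! ### Convergence of Mercer systems -/

section Cutoff

variable {𝒳 : Type*} {lam : ℕ → ℝ} {e : ℕ → 𝒳 → ℂ}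

/-- The kernel `∑ i, g (lam i) * e i x * conj (e i y)` of a function of the integral operator. -/
def calcKernel (g : ℝ → ℝ) (lam : ℕ → ℝ) (e : ℕ → 𝒳 → ℂ) (x y : 𝒳) : ℂ :=
  ∑' i, (g (lam i) : ℂ) * (e i x * (starRingEnd ℂ) (e i y))

/-- A continuous function that vanishes on `(-∞, c]` and equals `t⁻²` on `[d, ∞)`. -/
def cutoff (c d t : ℝ) : ℝ := max 0 (min 1 ((t - c) / (d - c))) / max t c ^ 2

variable {c d t : ℝ}

theorem continuous_cutoff (hc : 0 < c) : Continuous (cutoff c d) := by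
  unfold cutoff
  refine Continuous.div (by fun_prop) (by fun_prop) fun t => ?_
  have : 0 < max t c := lt_max_of_lt_right hc
  positivity

theorem cutoff_eq_zero (hd : c < d) (ht : t ≤ c) : cutoff c d t = 0 := by
  rw [cutoff, max_eq_left, zero_div]
  exact (min_le_right _ _).trans (div_nonpos_of_nonpos_of_nonneg (by linarith) (by linarith))

theorem cutoff_eq_inv_sq (hd : c < d) (ht : d ≤ t) : cutoff c d t = t⁻¹ ^ 2 := by
  rw [cutoff, max_eq_left (hd.le.trans ht), min_eq_left, max_eq_right zero_le_one, inv_pow,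
    one_div]
  rw [one_le_div (by linarith)]
  linarith

theorem cutoff_mul_sq_nonneg : 0 ≤ cutoff c d t * t ^ 2 := by
  unfold cutoff
  positivity

/-- Each eigenvalue adds at most `1` to the trace, which makes the trace a soft count of
eigenvalues. -/
theorem cutoff_mul_sq_le_one (hc : 0 < c) (ht : 0 ≤ t) : cutoff c d t * t ^ 2 ≤ 1 := by
  have h1 : 0 < max t c := lt_max_of_lt_right hc
  have h2 : t ^ 2 ≤ max t c ^ 2 := by
    gcongr
    exact le_max_left _ _
  have h3 : max 0 (min 1 ((t - c) / (d - c))) ≤ 1 := max_le zero_le_one (min_le_left _ _)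
  rw [cutoff, div_mul_eq_mul_div, div_le_one (by positivity)]
  nlinarith [sq_nonneg t]

theorem calcKernel_cutoff (hd : c < d) {ℓ : ℕ} (h1 : ∀ i < ℓ, d ≤ lam i) (h2 : ∀ i ≥ ℓ, lam i ≤ c)
    (x x' : 𝒳) : calcKernel (cutoff c d) lam e x x' = truncKernel lam e ℓ x x' := by
  rw [calcKernel, truncKernel, tsum_eq_sum (s := Finset.range ℓ)]
  · refine Finset.sum_congr rfl fun i hi => ?_
    rw [cutoff_eq_inv_sq hd (h1 i (Finset.mem_range.1 hi))]
    push_cast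
    rfl
  · intro i hi
    rw [cutoff_eq_zero hd (h2 i (by simpa using hi))]
    simp

end Cutoff

/-! ### Trace bounds and functional calculus for one Mercer system -/

section MercerSystem

variable {𝒳 : Type*} [MeasurableSpace 𝒳] {ρ : Measure 𝒳} {lam : ℕ → ℝ} {e : ℕ → 𝒳 → ℂ}
  {K : ℕ → 𝒳 → 𝒳 → ℂ} {U : Set 𝒳} {B : ℝ}

theorem MercerSystem.hasSum_norm_sq (h : MercerSystem ρ lam e K) (x : 𝒳) :
    HasSum (fun i => ‖e i x‖ ^ 2) (K 0 x x).re := by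
  refine (Complex.hasSum_re (h.hasSum 0 x x)).congr_fun fun i => ?_
  rw [pow_zero, one_mul, Complex.mul_conj, Complex.ofReal_re, Complex.normSq_eq_norm_sq]

/-- By the arithmetic-geometric mean inequality each term is at most `δ` times the mean of `‖e i
x‖²` and `‖e i x'‖²`, and these sum to the diagonal of `K 0`. The bound depends on the system only
through `B`. -/
theorem MercerSystem.norm_tsum_le (h : MercerSystem ρ lam e K)
    (hB : ∀ x ∈ U, (K 0 x x).re ≤ B) {c : ℕ → ℂ} {δ : ℝ} (hc : ∀ i, ‖c i‖ ≤ δ) {x x' : 𝒳}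
    (hx : x ∈ U) (hx' : x' ∈ U) :
    Summable (fun i => c i * (e i x * (starRingEnd ℂ) (e i x'))) ∧
      ‖∑' i, c i * (e i x * (starRingEnd ℂ) (e i x'))‖ ≤ δ * B := by
  have hδ : 0 ≤ δ := (norm_nonneg _).trans (hc 0)
  have h1 := ((h.hasSum_norm_sq x).add (h.hasSum_norm_sq x')).mul_left (δ / 2)
  have h2 : ∀ i, ‖c i * (e i x * (starRingEnd ℂ) (e i x'))‖ ≤
      δ / 2 * (‖e i x‖ ^ 2 + ‖e i x'‖ ^ 2) := by
    intro i
    rw [norm_mul, norm_mul, RCLike.norm_conj]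
    have h3 : ‖e i x‖ * ‖e i x'‖ ≤ (‖e i x‖ ^ 2 + ‖e i x'‖ ^ 2) / 2 := by
      nlinarith [sq_nonneg (‖e i x‖ - ‖e i x'‖)]
    calc _ ≤ δ * ((‖e i x‖ ^ 2 + ‖e i x'‖ ^ 2) / 2) :=
          mul_le_mul (hc i) h3 (by positivity) hδ
      _ = _ := by ring
  refine ⟨Summable.of_norm_bounded h1.summable h2, (tsum_of_norm_bounded h1 h2).trans ?_⟩
  nlinarith [hB x hx, hB x' hx']

/-- Integrate `∑ ‖e i x‖² ≤ K 0 x x ≤ B` over a measure of mass at most `1`; this is a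
Hilbert–Schmidt bound. -/
theorem MercerSystem.sum_sq_le (h : MercerSystem ρ lam e K) (hρ : ρ univ ≤ 1)
    (hU : ∀ᵐ x ∂ρ, x ∈ U) (hB : ∀ x ∈ U, (K 0 x x).re ≤ B) (hB0 : 0 ≤ B) (N : ℕ) :
    ∑ i ∈ Finset.range N, lam i ^ 2 ≤ B := by
  have : IsFiniteMeasure ρ := ⟨hρ.trans_lt ENNReal.one_lt_top⟩
  have h1 : ‖∫ x, ∑ i ∈ Finset.range N, e i x * (starRingEnd ℂ) (e i x) ∂ρ‖ ≤ B := by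
    refine (norm_integral_le_of_norm_le_const (C := B) ?_).trans ?_
    · filter_upwards [hU] with x hx
      refine (norm_sum_le _ _).trans (le_trans ?_ (hB x hx))
      refine (le_of_eq ?_).trans (sum_le_hasSum (Finset.range N) (fun i _ => by positivity)
        (h.hasSum_norm_sq x))
      refine Finset.sum_congr rfl fun i _ => ?_
      rw [norm_mul, RCLike.norm_conj, sq]
    · have : ρ.real univ ≤ 1 := ENNReal.toReal_le_of_le_ofReal zero_le_one (by simpa using hρ)
      nlinarith
  rw [integral_finsetSum _ fun i _ => h.integrable i] at h1
  simp only [h.integral_sq] at h1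
  refine le_trans (le_of_eq ?_) h1
  have h2 : (∑ i ∈ Finset.range N, (lam i : ℂ) ^ 2) =
      ((∑ i ∈ Finset.range N, lam i ^ 2 : ℝ) : ℂ) := by push_cast; rfl
  rw [h2, Complex.norm_real, Real.norm_of_nonneg (Finset.sum_nonneg fun i _ => sq_nonneg _)]

/-- From `λ_i² ≤ B ≤ (B + 1)²`. All systems with the bound `B` thus have their spectrum in one
interval, where a single polynomial can approximate `g`. -/
theorem MercerSystem.le_of_bound (h : MercerSystem ρ lam e K) (hρ : ρ univ ≤ 1)
    (hU : ∀ᵐ x ∂ρ, x ∈ U) (hB : ∀ x ∈ U, (K 0 x x).re ≤ B) (hB0 : 0 ≤ B) (i : ℕ) :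
    lam i ≤ B + 1 := by
  have h1 := h.sum_sq_le hρ hU hB hB0 (i + 1)
  rw [Finset.sum_range_succ] at h1
  have h2 : 0 ≤ ∑ j ∈ Finset.range i, lam j ^ 2 := Finset.sum_nonneg fun i _ => sq_nonneg _
  nlinarith

theorem MercerSystem.exists_lt (h : MercerSystem ρ lam e K) (hρ : ρ univ ≤ 1)
    (hU : ∀ᵐ x ∂ρ, x ∈ U) (hB : ∀ x ∈ U, (K 0 x x).re ≤ B) (hB0 : 0 ≤ B) {c : ℝ} (hc : 0 < c) :
    ∃ N, ∀ i ≥ N, lam i < c := by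
  obtain ⟨N, hN⟩ := exists_nat_gt (B / c ^ 2)
  refine ⟨N, fun i hi => lt_of_not_ge fun hle => ?_⟩
  have h1 := h.sum_sq_le hρ hU hB hB0 N
  have h2 : (N : ℝ) * c ^ 2 ≤ ∑ i ∈ Finset.range N, lam i ^ 2 := by
    rw [← nsmul_eq_mul]
    nth_rw 1 [← Finset.card_range N]
    refine Finset.card_nsmul_le_sum _ _ _ fun j hj => ?_
    have : c ≤ lam j := hle.trans (h.antitone ((Finset.mem_range.1 hj).le.trans hi))
    gcongr
  rw [div_lt_iff₀ (by positivity)] at hN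
  linarith

theorem MercerSystem.calcKernel_polynomial (h : MercerSystem ρ lam e K) (q : Polynomial ℝ)
    (x x' : 𝒳) :
    HasSum (fun i => ((q.eval (lam i) : ℝ) : ℂ) * (e i x * (starRingEnd ℂ) (e i x')))
      (∑ m ∈ Finset.range (q.natDegree + 1), (q.coeff m : ℂ) * K m x x') := by
  refine (hasSum_sum fun m _ => (h.hasSum m x x').mul_left (q.coeff m : ℂ)).congr_fun fun i => ?_
  rw [Polynomial.eval_eq_sum_range]
  push_cast
  rw [Finset.sum_mul]
  exact Finset.sum_congr rfl fun m _ => by ring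

theorem MercerSystem.norm_calcKernel_sub_le (h : MercerSystem ρ lam e K) (hρ : ρ univ ≤ 1)
    (hU : ∀ᵐ x ∂ρ, x ∈ U) (hB : ∀ x ∈ U, (K 0 x x).re ≤ B) (hB0 : 0 ≤ B)
    {g : ℝ → ℝ} {q : Polynomial ℝ} {δ : ℝ}
    (hq : ∀ t ∈ Icc 0 (B + 1), |q.eval t - g t| ≤ δ) {x x' : 𝒳} (hx : x ∈ U) (hx' : x' ∈ U) :
    ‖calcKernel g lam e x x' -
      ∑ m ∈ Finset.range (q.natDegree + 1), (q.coeff m : ℂ) * K m x x'‖ ≤ δ * B := by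
  have h1 := h.norm_tsum_le hB (c := fun i => ((q.eval (lam i) - g (lam i) : ℝ) : ℂ)) (δ := δ)
    (fun i => by
      rw [Complex.norm_real]
      exact hq _ ⟨h.nonneg i, h.le_of_bound hρ hU hB hB0 i⟩) hx hx'
  have h2 := h.calcKernel_polynomial q x x'
  have h3 : HasSum (fun i => (g (lam i) : ℂ) * (e i x * (starRingEnd ℂ) (e i x'))) _ :=
    (h2.sub h1.1.hasSum).congr_fun fun i => by push_cast; ring
  rw [calcKernel, h3.tsum_eq, norm_sub_rev, sub_sub_cancel]
  exact h1.2

theorem MercerSystem.integral_calcKernel (h : MercerSystem ρ lam e K) {g : ℝ → ℝ} {N : ℕ}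
    (hg : ∀ i ≥ N, g (lam i) = 0) :
    ∫ x, calcKernel g lam e x x ∂ρ =
      ((∑ i ∈ Finset.range N, g (lam i) * lam i ^ 2 : ℝ) : ℂ) := by
  have h1 : ∀ x, calcKernel g lam e x x =
      ∑ i ∈ Finset.range N, (g (lam i) : ℂ) * (e i x * (starRingEnd ℂ) (e i x)) := by
    intro x
    refine tsum_eq_sum fun i hi => ?_
    rw [hg i (by simpa using hi)]
    simp
  simp only [h1]
  rw [integral_finsetSum _ fun i _ => (h.integrable i).const_mul _]
  push_cast
  refine Finset.sum_congr rfl fun i _ => ?_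
  rw [integral_const_mul, h.integral_sq]

end MercerSystem

/-! ### Convergence of functional calculus kernels and persistence of the spectral gap -/

section Convergence

variable {𝒳 : Type*} [TopologicalSpace 𝒳] [MeasurableSpace 𝒳] {ρ : Measure 𝒳} {lam : ℕ → ℝ}
  {e : ℕ → 𝒳 → ℂ} {K : ℕ → 𝒳 → 𝒳 → ℂ} {U : Set 𝒳} {ρn : ℕ → Measure 𝒳} {lamn : ℕ → ℕ → ℝ}
  {en : ℕ → ℕ → 𝒳 → ℂ} {Kn : ℕ → ℕ → 𝒳 → 𝒳 → ℂ}

/-- A sequence of Mercer systems, over subprobability measures carried by the compact set `U`,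
that converges to a Mercer system. -/
structure MercerTendsto (U : Set 𝒳) (ρn : ℕ → Measure 𝒳) (lamn : ℕ → ℕ → ℝ)
    (en : ℕ → ℕ → 𝒳 → ℂ) (Kn : ℕ → ℕ → 𝒳 → 𝒳 → ℂ) (ρ : Measure 𝒳) (lam : ℕ → ℝ)
    (e : ℕ → 𝒳 → ℂ) (K : ℕ → 𝒳 → 𝒳 → ℂ) : Prop where
  isCompact : IsCompact U
  system : MercerSystem ρ lam e K
  systems : ∀ n, MercerSystem (ρn n) (lamn n) (en n) (Kn n)
  univ_le : ρ univ ≤ 1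
  univ_le' : ∀ n, ρn n univ ≤ 1
  ae_mem : ∀ᵐ x ∂ρ, x ∈ U
  ae_mem' : ∀ n, ∀ᵐ x ∂ρn n, x ∈ U
  continuous_kernel : ∀ m, Continuous (K m).uncurry
  continuous : ∀ i, Continuous (e i)
  tendsto_kernel : ∀ m, TendstoUniformlyOn (fun n => (Kn n m).uncurry) (K m).uncurry atTop
    (U ×ˢ U)
  tendsto_integral : ∀ (Fn : ℕ → 𝒳 → ℂ) (F : 𝒳 → ℂ), Continuous F →
    TendstoUniformlyOn Fn F atTop U →
    Tendsto (fun n => ∫ x, Fn n x ∂ρn n) atTop (𝓝 (∫ x, F x ∂ρ))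

theorem MercerTendsto.exists_bound (h : MercerTendsto U ρn lamn en Kn ρ lam e K) :
    ∃ B, 0 ≤ B ∧ (∀ x ∈ U, (K 0 x x).re ≤ B) ∧ ∀ᶠ n in atTop, ∀ x ∈ U, (Kn n 0 x x).re ≤ B := by
  obtain ⟨B, hB⟩ := (h.isCompact.prod h.isCompact).exists_bound_of_continuousOn
    (h.continuous_kernel 0).continuousOn
  have hB' : ∀ x ∈ U, ‖K 0 x x‖ ≤ |B| := fun x hx => (hB (x, x) ⟨hx, hx⟩).trans (le_abs_self B)
  refine ⟨|B| + 1, by positivity, fun x hx => ?_, ?_⟩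
  · linarith [Complex.re_le_norm (K 0 x x), hB' x hx]
  · filter_upwards [Metric.tendstoUniformlyOn_iff.1 (h.tendsto_kernel 0) 1 one_pos] with n hn x hx
    have h1 := hn (x, x) ⟨hx, hx⟩
    rw [dist_comm, dist_eq_norm] at h1
    have h2 : ‖Kn n 0 x x - K 0 x x‖ < 1 := h1
    have h3 := norm_sub_norm_le (Kn n 0 x x) (K 0 x x)
    linarith [Complex.re_le_norm (Kn n 0 x x), hB' x hx]

theorem tendstoUniformlyOn_finsetSum {P α : Type*} {F : α → ℕ → P → ℂ} {f : α → P → ℂ}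
    {T : Set P} (s : Finset α) (h : ∀ a ∈ s, TendstoUniformlyOn (F a) (f a) atTop T) :
    TendstoUniformlyOn (fun n p => ∑ a ∈ s, F a n p) (fun p => ∑ a ∈ s, f a p) atTop T := by
  classical
  induction s using Finset.induction_on with
  | empty =>
    simp only [Finset.sum_empty]
    exact Metric.tendstoUniformlyOn_iff.2 fun ε hε => by simp [hε]
  | insert a s ha ih =>
    simp only [Finset.sum_insert ha]
    exact (h a (Finset.mem_insert_self a s)).add
      (ih fun b hb => h b (Finset.mem_insert_of_mem hb))

/-- Replace `g` by a polynomial on `[0, B + 1]`: the error is at most `ε/3` for the limit and for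
all large `n`, and polynomial kernels are finite combinations of the `K m`. -/
theorem MercerTendsto.tendsto_calcKernel (h : MercerTendsto U ρn lamn en Kn ρ lam e K)
    {g : ℝ → ℝ} (hg : Continuous g) :
    TendstoUniformlyOn (fun n => (calcKernel g (lamn n) (en n)).uncurry)
      (calcKernel g lam e).uncurry atTop (U ×ˢ U) := by
  obtain ⟨B, hB0, hB, hBn⟩ := h.exists_bound
  rw [Metric.tendstoUniformlyOn_iff]
  intro ε hε
  obtain ⟨q, hq⟩ := exists_polynomial_near_of_continuousOn 0 (B + 1) g hg.continuousOn
    (ε / (3 * (B + 1))) (by positivity)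
  have hq' : ∀ t ∈ Icc 0 (B + 1), |q.eval t - g t| ≤ ε / (3 * (B + 1)) :=
    fun t ht => (hq t ht).le
  have hεB : ε / (3 * (B + 1)) * B ≤ ε / 3 := by
    rw [div_mul_eq_mul_div, div_le_div_iff₀ (by positivity) (by positivity)]
    nlinarith
  have hpoly : TendstoUniformlyOn
      (fun n (p : 𝒳 × 𝒳) => ∑ m ∈ Finset.range (q.natDegree + 1),
        (q.coeff m : ℂ) * Kn n m p.1 p.2)
      (fun p => ∑ m ∈ Finset.range (q.natDegree + 1), (q.coeff m : ℂ) * K m p.1 p.2) atTop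
      (U ×ˢ U) := by
    refine tendstoUniformlyOn_finsetSum _ fun m _ => ?_
    have hu : UniformContinuous fun z : ℂ => (q.coeff m : ℂ) * z :=
      uniformContinuous_const_smul (q.coeff m : ℂ)
    exact hu.comp_tendstoUniformlyOn (h.tendsto_kernel m)
  filter_upwards [hBn, Metric.tendstoUniformlyOn_iff.1 hpoly (ε / 3) (by positivity)]
    with n h1 h2 p hp
  have h3 := h.system.norm_calcKernel_sub_le h.univ_le h.ae_mem hB hB0 hq' hp.1 hp.2
  have h4 := (h.systems n).norm_calcKernel_sub_le (h.univ_le' n) (h.ae_mem' n) h1 hB0 hq' hp.1 hp.2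
  have h5 := h2 p hp
  rw [← dist_eq_norm] at h3 h4
  have h6 := dist_triangle4 (calcKernel g lam e p.1 p.2)
    (∑ m ∈ Finset.range (q.natDegree + 1), (q.coeff m : ℂ) * K m p.1 p.2)
    (∑ m ∈ Finset.range (q.natDegree + 1), (q.coeff m : ℂ) * Kn n m p.1 p.2)
    (calcKernel g (lamn n) (en n) p.1 p.2)
  rw [dist_comm] at h4
  change dist (calcKernel g lam e p.1 p.2) (calcKernel g (lamn n) (en n) p.1 p.2) < ε
  linarith

/-- The traces of the cutoff kernels converge to exactly `ℓ`. If `lamn n (ℓ - 1) ≤ c`, at most `ℓ -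
1` eigenvalues contribute and the trace is at most `ℓ - 1`; if `lamn n ℓ ≥ d`, it is at least `ℓ +
1`. Neither is possible once the trace is within `1` of `ℓ`. -/
theorem MercerTendsto.eventually_gap (h : MercerTendsto U ρn lamn en Kn ρ lam e K) {ℓ : ℕ}
    (hℓ : 1 ≤ ℓ) {c d : ℝ} (hc0 : 0 < c) (hcd : c < d) (hc : lam ℓ ≤ c) (hd : d ≤ lam (ℓ - 1)) :
    ∀ᶠ n in atTop, c < lamn n (ℓ - 1) ∧ lamn n ℓ < d := by
  obtain ⟨B, hB0, hB, hBn⟩ := h.exists_bound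
  have hlow : ∀ i ≥ ℓ, lam i ≤ c := fun i hi => (h.system.antitone hi).trans hc
  have hhigh : ∀ i < ℓ, d ≤ lam i := fun i hi => hd.trans (h.system.antitone (by omega))
  have hmul : ∀ t, d ≤ t → cutoff c d t * t ^ 2 = 1 := by
    intro t ht
    have : t ≠ 0 := by linarith
    rw [cutoff_eq_inv_sq hcd ht]
    field_simp
  have hcont : Continuous fun x => calcKernel (cutoff c d) lam e x x := by
    simp only [calcKernel_cutoff hcd hhigh hlow, truncKernel]
    exact continuous_finsetSum _ fun i _ => continuous_const.mul
      ((h.continuous i).mul (Complex.continuous_conj.comp (h.continuous i)))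
  have hlim := h.tendsto_integral (fun n x => calcKernel (cutoff c d) (lamn n) (en n) x x) _ hcont
    (((h.tendsto_calcKernel (continuous_cutoff hc0)).comp fun x => (x, x)).mono
      fun x hx => ⟨hx, hx⟩)
  rw [h.system.integral_calcKernel (N := ℓ) fun i hi => cutoff_eq_zero hcd (hlow i hi),
    Finset.sum_congr rfl fun i hi => hmul _ (hhigh i (Finset.mem_range.1 hi))] at hlim
  have hre := (Complex.continuous_re.tendsto _).comp hlim
  simp only [Finset.sum_const, Finset.card_range, nsmul_eq_mul, mul_one, Complex.ofReal_re] at hre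
  filter_upwards [hBn, Metric.tendsto_nhds.1 hre 1 one_pos] with n h1 h2
  simp only [Function.comp_apply] at h2
  rw [Real.dist_eq, abs_lt] at h2
  have hM := h.systems n
  constructor
  · by_contra! hle
    have hle' : ∀ i ≥ ℓ - 1, lamn n i ≤ c := fun i hi => (hM.antitone hi).trans hle
    rw [hM.integral_calcKernel fun i hi => cutoff_eq_zero hcd (hle' i hi),
      Complex.ofReal_re] at h2
    have h3 := Finset.sum_le_card_nsmul (Finset.range (ℓ - 1))
      (fun i => cutoff c d (lamn n i) * lamn n i ^ 2) 1
      fun i _ => cutoff_mul_sq_le_one hc0 (hM.nonneg i)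
    rw [Finset.card_range, nsmul_eq_mul, mul_one, Nat.cast_sub hℓ, Nat.cast_one] at h3
    linarith [h2.1]
  · by_contra! hle
    obtain ⟨N, hN⟩ := hM.exists_lt (h.univ_le' n) (h.ae_mem' n) h1 hB0 hc0
    rw [hM.integral_calcKernel (N := max N (ℓ + 1)) fun i hi =>
      cutoff_eq_zero hcd (hN i ((le_max_left _ _).trans hi)).le, Complex.ofReal_re] at h2
    have h3 : ∑ i ∈ Finset.range (ℓ + 1), cutoff c d (lamn n i) * lamn n i ^ 2 ≤
        ∑ i ∈ Finset.range (max N (ℓ + 1)), cutoff c d (lamn n i) * lamn n i ^ 2 :=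
      Finset.sum_le_sum_of_subset_of_nonneg (Finset.range_mono (le_max_right _ _))
        fun i _ _ => cutoff_mul_sq_nonneg
    rw [Finset.sum_congr rfl fun i hi => hmul _ (hle.trans (hM.antitone
      (Nat.lt_succ_iff.1 (Finset.mem_range.1 hi))))] at h3
    simp only [Finset.sum_const, Finset.card_range, nsmul_eq_mul, mul_one, Nat.cast_succ] at h3
    linarith [h2.2]

theorem MercerTendsto.tendsto_truncKernel (h : MercerTendsto U ρn lamn en Kn ρ lam e K) {ℓ : ℕ}
    (hℓ : 1 ≤ ℓ) (hgap : lam ℓ < lam (ℓ - 1)) :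
    (∀ᶠ n in atTop, ∀ i < ℓ, 0 < lamn n i) ∧
      TendstoUniformlyOn (fun n => (truncKernel (lamn n) (en n) ℓ).uncurry)
        (truncKernel lam e ℓ).uncurry atTop (U ×ˢ U) := by
  -- The pair `a₁ < a₂` eventually forces `lamn n ℓ < a₂`, and `a₃ < a₄` forces `a₃ < lamn n (ℓ -
  -- 1)`. The cutoff between `a₂` and `a₃` therefore truncates at the same `ℓ` for the limit and for
  -- all large `n`.
  obtain ⟨a₁, h01, h1⟩ := exists_between hgap
  obtain ⟨a₂, h12, h2⟩ := exists_between h1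
  obtain ⟨a₃, h23, h3⟩ := exists_between h2
  obtain ⟨a₄, h34, h4⟩ := exists_between h3
  have h0 : 0 ≤ lam ℓ := h.system.nonneg ℓ
  have hev : ∀ᶠ n in atTop, (∀ i < ℓ, a₃ ≤ lamn n i) ∧ ∀ i ≥ ℓ, lamn n i ≤ a₂ := by
    filter_upwards [h.eventually_gap hℓ (by linarith) h12 h01.le h2.le,
      h.eventually_gap hℓ (by linarith) h34 (by linarith) h4.le] with n hn hn'
    exact ⟨fun i hi => hn'.1.le.trans ((h.systems n).antitone (by omega)),
      fun i hi => ((h.systems n).antitone hi).trans hn.2.le⟩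
  refine ⟨hev.mono fun n hn i hi => lt_of_lt_of_le (by linarith) (hn.1 i hi), ?_⟩
  have key := h.tendsto_calcKernel (continuous_cutoff (c := a₂) (d := a₃) (by linarith))
  refine (key.congr ?_).congr_right ?_
  · filter_upwards [hev] with n hn p _
    exact calcKernel_cutoff h23 hn.1 hn.2 p.1 p.2
  · intro p _
    exact calcKernel_cutoff h23 (fun i hi => h3.le.trans (h.system.antitone (by omega)))
      (fun i hi => (h.system.antitone hi).trans (by linarith)) p.1 p.2

end Convergence

/-! ### The limit measure is carried by its support -/

/-- The truncated distance to the orbit is a bounded continuous test function with all sample means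
zero, so its `μ`-integral vanishes. -/
theorem ae_mem_closure_range_of_tendsto {Ω : Type*} [MetricSpace Ω] [MeasurableSpace Ω]
    [BorelSpace Ω] {μ : Measure Ω} [IsFiniteMeasure μ] {p : ℕ → Ω}
    (hweak : ∀ g : BoundedContinuousFunction Ω ℂ,
      Tendsto (fun n => ∫ ω, g ω ∂(empMeasure p n)) atTop (𝓝 (∫ ω, g ω ∂μ))) :
    ∀ᵐ ω ∂μ, ω ∈ closure (range p) := by
  have hne : (range p).Nonempty := range_nonempty p
  let r : Ω → ℝ := fun ω => min 1 (Metric.infDist ω (range p))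
  have hrc : Continuous r := continuous_const.min (Metric.continuous_infDist_pt _)
  have hr0 : ∀ ω, 0 ≤ r ω := fun ω => le_min zero_le_one Metric.infDist_nonneg
  have hrb : ∀ ω, ‖(r ω : ℂ)‖ ≤ 1 := fun ω => by
    rw [Complex.norm_real, Real.norm_of_nonneg (hr0 ω)]
    exact min_le_left _ _
  have hrp : ∀ j, r (p j) = 0 := fun j => by
    have : Metric.infDist (p j) (range p) = 0 := Metric.infDist_zero_of_mem (mem_range_self j)
    simp [r, this]
  have key := hweak (BoundedContinuousFunction.ofNormedAddCommGroup (fun ω => (r ω : ℂ))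
    (Complex.continuous_ofReal.comp hrc) 1 hrb)
  simp only [BoundedContinuousFunction.coe_ofNormedAddCommGroup, integral_empMeasure, hrp,
    sampleMean, Complex.ofReal_zero, Finset.sum_const_zero, mul_zero] at key
  have h0 := tendsto_nhds_unique key tendsto_const_nhds
  rw [integral_complex_ofReal, Complex.ofReal_eq_zero, integral_eq_zero_iff_of_nonneg hr0] at h0
  · filter_upwards [h0] with ω hω
    rw [Metric.mem_closure_iff_infDist_zero hne]
    have h1 : min 1 (Metric.infDist ω (range p)) = 0 := hω
    rcases min_choice 1 (Metric.infDist ω (range p)) with h | h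
    · linarith
    · linarith
  · refine Integrable.of_bound hrc.aestronglyMeasurable 1 (Eventually.of_forall fun ω => ?_)
    simpa using hrb ω

/-- A separable metric set is Lindelöf, so countably many null sets cover its part outside the
support. Separability is needed to pass from local to global nullity, and the orbit closure provides
it. -/
theorem ae_mem_support_of_ae_mem_isSeparable {Ω : Type*} [MetricSpace Ω] [MeasurableSpace Ω]
    {μ : Measure Ω} {S : Set Ω} (hS : TopologicalSpace.IsSeparable S)
    (hμ : ∀ᵐ ω ∂μ, ω ∈ S) : ∀ᵐ ω ∂μ, ω ∈ μ.support := by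
  have hL : IsLindelof (S ∩ μ.supportᶜ) := by
    have : TopologicalSpace.SeparableSpace ↥(S ∩ μ.supportᶜ) :=
      (hS.mono inter_subset_left).separableSpace
    have := UniformSpace.secondCountable_of_separable ↥(S ∩ μ.supportᶜ)
    rw [isLindelof_iff_isLindelof_univ]
    exact isLindelof_univ
  have h1 : (S ∩ μ.supportᶜ)ᶜ ∈ ae μ := by
    refine hL.compl_mem_sets_of_nhdsWithin fun ω hω => ?_
    obtain ⟨V, hV, hV0⟩ := Measure.notMem_support_iff_exists.1 hω.2
    exact ⟨V, mem_nhdsWithin_of_mem_nhds hV, compl_mem_ae_iff.2 hV0⟩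
  filter_upwards [hμ, h1] with ω h2 h3
  by_contra h4
  exact h3 ⟨h2, h4⟩

theorem mem_support_map_of_mem_support {Ω 𝒳 : Type*} [TopologicalSpace Ω] [MeasurableSpace Ω]
    [OpensMeasurableSpace Ω] [TopologicalSpace 𝒳] [MeasurableSpace 𝒳] [BorelSpace 𝒳]
    {μ : Measure Ω} {X : Ω → 𝒳} (hX : Continuous X) {ω : Ω} (hω : ω ∈ μ.support) :
    X ω ∈ (μ.map X).support := by
  rw [Measure.mem_support_iff_forall] at hω ⊢
  intro V hV
  obtain ⟨W, hWV, hW, hXW⟩ := mem_nhds_iff.1 hV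
  refine lt_of_lt_of_le ?_ (measure_mono hWV)
  rw [Measure.map_apply hX.measurable hW.measurableSet]
  exact hω _ ((hW.preimage hX).mem_nhds hXW)

/-! ### The regression function is the conditional expectation -/

/-- Every set of the σ-algebra of `X` is some `X ⁻¹' B`, whose indicator is the pullback of that of
`B`. The adjoint relation against it is the defining identity of the conditional expectation. -/
theorem regression_comp_ae_eq_condExp {S T : Type*} {mS : MeasurableSpace S}
    [mT : MeasurableSpace T] {μ : Measure S} [IsFiniteMeasure μ] {X : S → T} (hX : Measurable X)
    {g : S → ℂ} (hg : MemLp g 2 μ) :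
    (fun s => regression μ hX g (X s)) =ᵐ[μ] μ[g | MeasurableSpace.comap X mT] := by
  have hm : MeasurableSpace.comap X mT ≤ mS := hX.comap_le
  have hR : MemLp (fun s => regression μ hX g (X s)) 2 μ :=
    (Lp.memLp (regression μ hX g)).comp_measurePreserving (hX.measurePreserving μ)
  refine ae_eq_condExp_of_forall_setIntegral_eq hm (hg.integrable one_le_two)
    (fun _ _ _ => (hR.integrable one_le_two).integrableOn) ?_ ?_
  · rintro _ ⟨B, hB, rfl⟩ _
    have hμB : μ.map X B ≠ ∞ := measure_ne_top _ _
    have h1 : ⟪indicatorConstLp 2 hB hμB (1 : ℂ), regression μ hX g⟫_ℂ =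
        ⟪pullback μ hX (indicatorConstLp 2 hB hμB (1 : ℂ)), toL2 μ g⟫_ℂ := by
      rw [regression, ContinuousLinearMap.adjoint_inner_right]
    have h2 : pullback μ hX (indicatorConstLp 2 hB hμB (1 : ℂ)) =
        indicatorConstLp 2 (hX hB) (measure_ne_top μ _) (1 : ℂ) := by
      refine Lp.ext ?_
      have h3 : (pullback μ hX (indicatorConstLp 2 hB hμB (1 : ℂ)) : S → ℂ) =ᵐ[μ]
          indicatorConstLp 2 hB hμB (1 : ℂ) ∘ X :=
        Lp.coeFn_compMeasurePreserving _ (hX.measurePreserving μ)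
      filter_upwards [h3, (hX.measurePreserving μ).quasiMeasurePreserving.ae
        (indicatorConstLp_coeFn (p := 2) (hs := hB) (hμs := hμB) (c := (1 : ℂ))),
        indicatorConstLp_coeFn (p := 2) (hs := hX hB) (hμs := measure_ne_top μ _) (c := (1 : ℂ))]
        with s h4 h5 h6
      rw [h4, h6, Function.comp_apply, h5]
      rfl
    rw [h2, L2.inner_indicatorConstLp_one, L2.inner_indicatorConstLp_one] at h1
    rw [setIntegral_map hB (Lp.aestronglyMeasurable _) hX.aemeasurable] at h1
    rw [h1, toL2, dif_pos hg]
    refine integral_congr_ae (ae_restrict_of_ae ?_)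
    exact hg.coeFn_toLp
  · have h1 : StronglyMeasurable[MeasurableSpace.comap X mT]
        fun s => regression μ hX g (X s) :=
      (Lp.stronglyMeasurable (regression μ hX g)).comp_measurable (comap_measurable X)
    exact h1.aestronglyMeasurable

/-! ### Continuity of the regression function in the lead time -/

theorem regression_eq {S T : Type*} [MeasurableSpace S] [MeasurableSpace T] {μ : Measure S}
    {X : S → T} (hX : Measurable X) {g : S → ℂ} (hg : MemLp g 2 μ) :
    regression μ hX g = ContinuousLinearMap.adjoint (pullback μ hX) (hg.toLp g) := by
  rw [regression, toL2, dif_pos hg]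

/-- Dominated convergence for `‖g t - g t₀‖²`, with the constant `(2C)²` as majorant. -/
theorem continuous_toLp_of_bounded {P S : Type*} [TopologicalSpace P] [FirstCountableTopology P]
    [MeasurableSpace S] {μ : Measure S} [IsFiniteMeasure μ] {g : P → S → ℂ}
    (hm : ∀ t, Measurable (g t)) (hg : ∀ t, MemLp (g t) 2 μ) {C : ℝ} (hC : ∀ t, ∀ᵐ s ∂μ, ‖g t s‖ ≤ C)
    (hc : ∀ s, Continuous fun t => g t s) : Continuous fun t => (hg t).toLp (g t) := by
  rw [continuous_iff_continuousAt]
  intro t₀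
  rw [ContinuousAt, Lp.tendsto_Lp_iff_tendsto_eLpNorm'']
  have h1 : ∀ t, eLpNorm (g t - g t₀) 2 μ = (∫⁻ s, ‖g t s - g t₀ s‖ₑ ^ (2 : ℝ) ∂μ) ^ (1 / 2 : ℝ) := by
    intro t
    rw [eLpNorm_eq_lintegral_rpow_enorm_toReal (by simp) (by simp)]
    simp
  simp only [h1]
  have h2 : Tendsto (fun t => ∫⁻ s, ‖g t s - g t₀ s‖ₑ ^ (2 : ℝ) ∂μ) (𝓝 t₀)
      (𝓝 (∫⁻ _, 0 ∂μ)) := by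
    refine tendsto_lintegral_filter_of_dominated_convergence
      (fun _ => ENNReal.ofReal (C + C) ^ (2 : ℝ)) ?_ ?_ ?_ ?_
    · exact Eventually.of_forall fun t => ((hm t).sub (hm t₀)).enorm.pow_const _
    · refine Eventually.of_forall fun t => ?_
      filter_upwards [hC t, hC t₀] with s h3 h4
      gcongr
      rw [← ofReal_norm]
      exact ENNReal.ofReal_le_ofReal ((norm_sub_le _ _).trans (add_le_add h3 h4))
    · rw [lintegral_const]
      exact ENNReal.mul_ne_top (ENNReal.rpow_ne_top_of_nonneg (by norm_num) ENNReal.ofReal_ne_top)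
        (measure_ne_top _ _)
    · refine Eventually.of_forall fun s => ?_
      have h3 : Continuous fun t => ‖g t s - g t₀ s‖ₑ ^ (2 : ℝ) := by
        have := ((hc s).sub (continuous_const (y := g t₀ s))).enorm
        fun_prop
      simpa using h3.tendsto t₀
  have h3 := (ENNReal.continuous_rpow_const (y := (1 / 2 : ℝ))).tendsto _ |>.comp h2
  simpa [Function.comp_def] using h3

/-! ### Convergence of the empirical target functions -/

section Emp

variable {Ω 𝒳 : Type*} [MetricSpace Ω] [MeasurableSpace Ω] [BorelSpace Ω] [MetricSpace 𝒳]
  [MeasurableSpace 𝒳] [BorelSpace 𝒳] {μ : Measure Ω} [IsProbabilityMeasure μ] {X : Ω → 𝒳}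
  {U : Set 𝒳} {p : ℕ → Ω} {𝓚 : Type*} [NormedAddCommGroup 𝓚] [InnerProductSpace ℂ 𝓚]
  [CompleteSpace 𝓚] [RKHS ℂ 𝓚 𝒳 ℂ] {𝓚Emp : ℕ → Type*} [∀ n, NormedAddCommGroup (𝓚Emp n)]
  [∀ n, InnerProductSpace ℂ (𝓚Emp n)] [∀ n, CompleteSpace (𝓚Emp n)] [∀ n, RKHS ℂ (𝓚Emp n) 𝒳 ℂ]

/-- Induction along `kerPow_succ`: each step is a sample mean of weight `1` whose parameter is the
pair `(x, x')` in `U × U`. -/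
theorem Samples.tendsto_kerPow (hS : Samples p μ (X ⁻¹' U)) (hX : Continuous X) (hU : IsCompact U)
    (hk : Continuous fun q : 𝒳 × 𝒳 => scalarKernel 𝓚 q.1 q.2)
    (hkconv : TendstoUniformlyOn (fun n (q : 𝒳 × 𝒳) => scalarKernel (𝓚Emp n) q.1 q.2)
      (fun q => scalarKernel 𝓚 q.1 q.2) atTop (U ×ˢ U))
    (h : ∀ f : 𝓚, MemLp (⇑f) 2 (μ.map X))
    (hEmp : ∀ n, ∀ f : 𝓚Emp n, MemLp (⇑f) 2 (empMeasure (fun j => X (p j)) n)) (m : ℕ) :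
    TendstoUniformlyOn
      (fun n => (kerPow (𝓚Emp n) (empMeasure (fun j => X (p j)) n) m).uncurry)
      (kerPow 𝓚 (μ.map X) m).uncurry atTop (U ×ˢ U) := by
  induction m with
  | zero =>
    simpa only [Function.uncurry_def, kerPow_zero] using hkconv
  | succ m ih =>
    have hc := continuous_kerPow (μ.map X) hk m
    have hF : Continuous (Function.uncurry fun (t : 𝒳 × 𝒳) (y : 𝒳) =>
        scalarKernel 𝓚 t.1 y * kerPow 𝓚 (μ.map X) m y t.2) :=
      (hk.comp (continuous_fst.fst.prodMk continuous_snd)).mul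
        (hc.comp (continuous_snd.prodMk continuous_fst.snd))
    have hUU := (hU.prod hU)
    have hconv : TendstoUniformlyOn (fun n => Function.uncurry fun (t : 𝒳 × 𝒳) (y : 𝒳) =>
        scalarKernel (𝓚Emp n) t.1 y * kerPow (𝓚Emp n) (empMeasure (fun j => X (p j)) n) m y t.2)
        (Function.uncurry fun (t : 𝒳 × 𝒳) (y : 𝒳) =>
          scalarKernel 𝓚 t.1 y * kerPow 𝓚 (μ.map X) m y t.2) atTop ((U ×ˢ U) ×ˢ U) := by
      refine TendstoUniformlyOn.mul_of_bounded
        ((hkconv.comp fun s : (𝒳 × 𝒳) × 𝒳 => (s.1.1, s.2)).mono fun s hs => ⟨hs.1.1, hs.2⟩)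
        ((ih.comp fun s : (𝒳 × 𝒳) × 𝒳 => (s.2, s.1.2)).mono fun s hs => ⟨hs.2, hs.1.2⟩) ?_ ?_
      · obtain ⟨C, hC⟩ := hUU.exists_bound_of_continuousOn hk.continuousOn
        exact ⟨C, fun s hs => hC (s.1.1, s.2) ⟨hs.1.1, hs.2⟩⟩
      · obtain ⟨C, hC⟩ := hUU.exists_bound_of_continuousOn hc.continuousOn
        exact ⟨C, fun s hs => hC (s.2, s.1.2) ⟨hs.2, hs.1.2⟩⟩
    have key := hS.tendstoUniformlyOn_sampleMean_of_tendstoUniformlyOn hX hU hUU hF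
      (w := fun _ => 1) continuous_const ⟨1, by simp⟩ hconv (wn := fun _ _ => 1) ⟨1, by simp⟩
      (by simp)
    simp only [mul_one] at key
    refine (key.congr ?_).congr_right ?_
    · refine Eventually.of_forall fun n q _ => ?_
      simp only [Function.uncurry_def]
      rw [kerPow_succ (hEmp n), integral_empMeasure]
    · intro q _
      simp only [Function.uncurry_def]
      rw [kerPow_succ h, integral_map hX.aemeasurable]
      exact ((hk.comp (continuous_const (y := q.1).prodMk continuous_id)).mul
        (hc.comp (continuous_id.prodMk (continuous_const (y := q.2))))).aestronglyMeasurable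

theorem Samples.mercerTendsto (hS : Samples p μ (X ⁻¹' U)) (hX : Continuous X) (hU : IsCompact U)
    (hk : Continuous fun q : 𝒳 × 𝒳 => scalarKernel 𝓚 q.1 q.2)
    (hkconv : TendstoUniformlyOn (fun n (q : 𝒳 × 𝒳) => scalarKernel (𝓚Emp n) q.1 q.2)
      (fun q => scalarKernel 𝓚 q.1 q.2) atTop (U ×ˢ U))
    (h : ∀ f : 𝓚, MemLp (⇑f) 2 (μ.map X))
    (hEmp : ∀ n, ∀ f : 𝓚Emp n, MemLp (⇑f) 2 (empMeasure (fun j => X (p j)) n))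
    {lam : ℕ → ℝ} {φ : ℕ → Lp ℂ 2 (μ.map X)}
    (heig : IsEigensystem (kernelOp 𝓚 (μ.map X)) lam φ) {lamEmp : ℕ → ℕ → ℝ}
    {φEmp : ∀ n, ℕ → Lp ℂ 2 (empMeasure (fun j => X (p j)) n)}
    (heigEmp : ∀ n, IsEigensystem (kernelOp (𝓚Emp n) (empMeasure (fun j => X (p j)) n))
      (lamEmp n) (φEmp n)) :
    MercerTendsto U (fun n => empMeasure (fun j => X (p j)) n) lamEmp
      (fun n i => ⇑(eigFun (incl (𝓚Emp n) (empMeasure (fun j => X (p j)) n)) (lamEmp n)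
        (φEmp n) i))
      (fun n m => kerPow (𝓚Emp n) (empMeasure (fun j => X (p j)) n) (m + 1))
      (μ.map X) lam (fun i => ⇑(eigFun (incl 𝓚 (μ.map X)) lam φ i))
      (fun m => kerPow 𝓚 (μ.map X) (m + 1)) where
  isCompact := hU
  system := heig.mercerSystem h
  systems n := (heigEmp n).mercerSystem (hEmp n)
  univ_le := by
    rw [Measure.map_apply hX.measurable MeasurableSet.univ]
    exact prob_le_one
  univ_le' n := empMeasure_univ_le_one _ n
  ae_mem := (ae_map_iff hX.aemeasurable hU.measurableSet).2 hS.ae_mem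
  ae_mem' n := ae_empMeasure_mem hU.measurableSet hS.mem
  continuous_kernel m := continuous_kerPow _ hk _
  continuous i := continuous_of_continuous_kernel hk _
  tendsto_kernel m := hS.tendsto_kerPow hX hU hk hkconv h hEmp (m + 1)
  tendsto_integral Fn F hF hFn := by
    -- No parameter is involved here, so the parameter space is a single point.
    have key := hS.tendstoUniformlyOn_sampleMean_of_tendstoUniformlyOn hX hU
      (isCompact_univ (X := Unit)) (F := fun _ => F) (hF.comp continuous_snd)
      (w := fun _ => 1) continuous_const ⟨1, by simp⟩ (Fn := fun n _ => Fn n)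
      ((hFn.comp Prod.snd).mono fun s hs => hs.2) (wn := fun _ _ => 1) ⟨1, by simp⟩ (by simp)
    have h1 := key.tendsto_at (mem_univ ())
    simp only [mul_one] at h1
    rw [integral_map hX.aemeasurable hF.aestronglyMeasurable]
    simpa only [integral_empMeasure] using h1

/-- At most `q` summands are nonzero and each is at most `C`, so the mean is at most `qC/n`. -/
theorem tendsto_mean_norm_shift_sub {u : ℕ → ℂ} {C : ℝ} (hu : ∀ j, ‖u j‖ ≤ C) (q : ℕ) :
    Tendsto (fun n : ℕ => (n : ℝ)⁻¹ *
      ∑ j ∈ Finset.range n, ‖(if j + q < n then u j else 0) - u j‖) atTop (𝓝 0) := by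
  have hC : 0 ≤ C := (norm_nonneg _).trans (hu 0)
  have h1 : Tendsto (fun n : ℕ => (n : ℝ)⁻¹ * (q * C)) atTop (𝓝 0) := by
    simpa using (tendsto_inv_atTop_nhds_zero_nat (𝕜 := ℝ)).mul_const (q * C)
  refine squeeze_zero (fun n => by positivity) (fun n => ?_) h1
  gcongr
  have h2 : ∀ j ∈ Finset.range n, ‖(if j + q < n then u j else 0) - u j‖ ≤
      if n ≤ j + q then C else 0 := by
    intro j _
    by_cases hj : j + q < n
    · rw [if_pos hj, if_neg (by omega)]
      simp
    · simpa [hj, not_lt.1 hj] using hu j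
  refine (Finset.sum_le_sum h2).trans ?_
  rw [← Finset.sum_filter, Finset.sum_const, nsmul_eq_mul]
  gcongr
  calc ((Finset.range n).filter fun j => n ≤ j + q).card ≤ (Finset.Ico (n - q) n).card := by
        refine Finset.card_le_card fun j hj => ?_
        simp only [Finset.mem_filter, Finset.mem_range, Finset.mem_Ico] at hj ⊢
        omega
    _ ≤ q := by
        rw [Nat.card_Ico]
        omega

theorem memLp_indexMeasure (n : ℕ) (u : Fin n → ℂ) : MemLp u 2 (indexMeasure n) :=
  MemLp.of_bound (by fun_prop) (∑ j, ‖u j‖) (Eventually.of_forall fun j =>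
    Finset.single_le_sum (f := fun j => ‖u j‖) (fun _ _ => norm_nonneg _) (Finset.mem_univ j))

theorem Samples.tendsto_empTarget (hS : Samples p μ (X ⁻¹' U)) (hX : Continuous X)
    (hU : IsCompact U) (hk : Continuous fun q : 𝒳 × 𝒳 => scalarKernel 𝓚 q.1 q.2)
    (hkEmp : ∀ n, Continuous fun q : 𝒳 × 𝒳 => scalarKernel (𝓚Emp n) q.1 q.2)
    (hkconv : TendstoUniformlyOn (fun n (q : 𝒳 × 𝒳) => scalarKernel (𝓚Emp n) q.1 q.2)
      (fun q => scalarKernel 𝓚 q.1 q.2) atTop (U ×ˢ U))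
    {lam : ℕ → ℝ} {φ : ℕ → Lp ℂ 2 (μ.map X)}
    (heig : IsEigensystem (kernelOp 𝓚 (μ.map X)) lam φ) {lamEmp : ℕ → ℕ → ℝ}
    {φEmp : ∀ n, ℕ → Lp ℂ 2 (empMeasure (fun j => X (p j)) n)}
    (heigEmp : ∀ n, IsEigensystem (kernelOp (𝓚Emp n) (empMeasure (fun j => X (p j)) n))
      (lamEmp n) (φEmp n)) {ℓ : ℕ} (hℓ : 1 ≤ ℓ) (hgap : lam ℓ < lam (ℓ - 1)) {q : ℕ}
    {y : ℕ → ℂ} {w : Ω → ℂ} (hw : Continuous w) (hwb : ∃ C, ∀ ω, X ω ∈ U → ‖w ω‖ ≤ C)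
    (hwL : MemLp w 2 μ) (hy : ∀ j, y (j + q) = w (p j)) :
    TendstoUniformlyOn
      (fun n x => empTarget (fun j => X (p j)) y n (𝓚Emp n) (lamEmp n) (φEmp n) q ℓ x)
      (fun x => idealTarget μ hX.measurable 𝓚 lam φ w ℓ x) atTop U := by
  have h : ∀ f : 𝓚, MemLp (⇑f) 2 (μ.map X) := fun f =>
    memLp_of_continuous_kernel hk _ hU
      ((ae_map_iff hX.aemeasurable hU.measurableSet).2 hS.ae_mem) f
  have hEmp : ∀ n, ∀ f : 𝓚Emp n, MemLp (⇑f) 2 (empMeasure (fun j => X (p j)) n) := fun n f =>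
    memLp_of_continuous_kernel (hkEmp n) _ hU (ae_empMeasure_mem hU.measurableSet hS.mem) f
  have hM := hS.mercerTendsto hX hU hk hkconv h hEmp heig heigEmp
  obtain ⟨hpos, htrunc⟩ := hM.tendsto_truncKernel hℓ hgap
  have hcont : Continuous (truncKernel lam (fun i => ⇑(eigFun (incl 𝓚 (μ.map X)) lam φ i))
      ℓ).uncurry := by
    have hc := hM.continuous
    simp only [Function.uncurry_def, truncKernel]
    exact continuous_finsetSum _ fun i _ => continuous_const.mul (((hc i).comp continuous_fst).mul
      (Complex.continuous_conj.comp ((hc i).comp continuous_snd)))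
  obtain ⟨C, hC⟩ := id hwb
  have hu : ∀ j, ‖w (p j)‖ ≤ C := fun j => hC _ (hS.mem j)
  have key := hS.tendstoUniformlyOn_sampleMean_of_tendstoUniformlyOn hX hU hU hcont hw hwb htrunc
    (wn := fun n j => if j + q < n then w (p j) else 0)
    ⟨C, fun n j => by
      split_ifs
      · exact hu j
      · simpa using (norm_nonneg _).trans (hu 0)⟩
    (tendsto_mean_norm_shift_sub hu q)
  refine (key.congr ?_).congr_right ?_
  -- The integral formula requires the first `ℓ` empirical eigenvalues to be positive, which is
  -- known only for large `n`.
  · filter_upwards [hpos] with n hn x _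
    have h1 := target_regression_apply (μ := indexMeasure n) (X := fun j : Fin n => X (p j))
      Measurable.of_discrete (hEmp n) (memLp_indexMeasure n (analogVec y q n)) (heigEmp n) hn x
    refine Eq.trans ?_ h1.symm
    simp only
    rw [← integral_indexMeasure]
    refine integral_congr_ae (Eventually.of_forall fun j => ?_)
    simp only [analogVec, hy]
    rfl
  · intro x _
    exact (target_regression_apply hX.measurable h hwL heig (fun i hi =>
      (hM.system.nonneg ℓ).trans_lt (hgap.trans_le (heig.antitone (by omega)))) x).symm

end Emp

/-! ### Lead times in compact sets -/

theorem finite_setOf_natCast_mul_mem {Δt : ℝ≥0} (hΔt : 0 < Δt) {T : Set ℝ≥0} (hT : IsCompact T) :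
    {q : ℕ | q * Δt ∈ T}.Finite := by
  obtain ⟨R, hR⟩ := hT.bddAbove
  obtain ⟨N, hN⟩ := exists_nat_gt (R / Δt)
  refine (Set.finite_Iic N).subset fun q hq => ?_
  have h1 : (q : ℝ≥0) * Δt ≤ R := hR hq
  rw [div_lt_iff₀ hΔt] at hN
  exact_mod_cast (lt_of_mul_lt_mul_right (h1.trans_lt hN) hΔt.le).le

theorem tendstoUniformlyOn_finite_prod {A P E : Type*} [PseudoMetricSpace E] {F : ℕ → A → P → E}
    {f : A → P → E} {s : Set A} {T : Set P} (hs : s.Finite)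
    (h : ∀ a ∈ s, TendstoUniformlyOn (fun n => F n a) (f a) atTop T) :
    TendstoUniformlyOn (fun n (q : A × P) => F n q.1 q.2) (fun q => f q.1 q.2) atTop
      (s ×ˢ T) := by
  rw [Metric.tendstoUniformlyOn_iff]
  intro ε hε
  filter_upwards [(Set.Finite.eventually_all hs).2 fun a ha =>
    Metric.tendstoUniformlyOn_iff.1 (h a ha) ε hε] with n hn q hq
  exact hn q.1 hq.1 q.2 hq.2

end

end KAF

/-! ### Proof of the theorem -/

theorem mainTheorem1
    {Ω 𝒳 : Type*} [MetricSpace Ω] [MeasurableSpace Ω] [BorelSpace Ω]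
    [MetricSpace 𝒳] [MeasurableSpace 𝒳] [BorelSpace 𝒳]
    -- the invariant measure, with compact support
    (μ : Measure Ω) [IsProbabilityMeasure μ] (hμ : IsCompact μ.support)
    -- the dynamics: a semigroup of continuous measure-preserving maps
    (Φ : ℝ≥0 → Ω → Ω) (hΦ0 : Φ 0 = id) (hΦadd : ∀ s t, Φ (s + t) = Φ s ∘ Φ t)
    (hΦc : ∀ t, Continuous (Φ t)) (hΦμ : ∀ t, MeasurePreserving (Φ t) μ μ)
    -- covariate and response
    (X : Ω → 𝒳) (hX : Continuous X) (Y : Ω → ℂ) (hY : Continuous Y)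
    -- the training orbit, and weak convergence of its empirical measures
    (Δt : ℝ≥0) (hΔt : 0 < Δt) (ω₁ : Ω)
    (hweak : ∀ g : BoundedContinuousFunction Ω ℂ,
      Tendsto (fun n => ∫ ω, g ω ∂(KAF.empMeasure (KAF.orbit Φ Δt ω₁) n)) atTop
        (𝓝 (∫ ω, g ω ∂μ)))
    -- the compact set containing the covariate data and the support of its limit law
    (U : Set 𝒳) (hU : IsCompact U) (hUsupp : (μ.map X).support ⊆ U)
    (hUdata : ∀ j, X (KAF.orbit Φ Δt ω₁ j) ∈ U)
    (hYbdd : ∀ q : ℕ, ∃ C : ℝ, ∀ ω, X ω ∈ U → ‖Y (Φ (q * Δt) ω)‖ ≤ C)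
    -- the ideal and the empirical reproducing kernel Hilbert spaces, with continuous kernels
    (𝓚 : Type*) [NormedAddCommGroup 𝓚] [InnerProductSpace ℂ 𝓚] [CompleteSpace 𝓚]
    [RKHS ℂ 𝓚 𝒳 ℂ]
    (𝓚Emp : ℕ → Type*) [∀ n, NormedAddCommGroup (𝓚Emp n)] [∀ n, InnerProductSpace ℂ (𝓚Emp n)]
    [∀ n, CompleteSpace (𝓚Emp n)] [∀ n, RKHS ℂ (𝓚Emp n) 𝒳 ℂ]
    (hk : Continuous fun p : 𝒳 × 𝒳 => KAF.scalarKernel 𝓚 p.1 p.2)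
    (hkEmp : ∀ n, Continuous fun p : 𝒳 × 𝒳 => KAF.scalarKernel (𝓚Emp n) p.1 p.2)
    (hkconv : TendstoUniformlyOn
      (fun n (p : 𝒳 × 𝒳) => KAF.scalarKernel (𝓚Emp n) p.1 p.2)
      (fun p => KAF.scalarKernel 𝓚 p.1 p.2) atTop (U ×ˢ U))
    -- eigenvalues and orthonormal eigenfunctions of the integral operators
    (lam : ℕ → ℝ) (φ : ℕ → Lp ℂ 2 (μ.map X))
    (heig : KAF.IsEigensystem (KAF.kernelOp 𝓚 (μ.map X)) lam φ)
    (lamEmp : ℕ → ℕ → ℝ)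
    (φEmp : ∀ n, ℕ → Lp ℂ 2 (KAF.empMeasure (fun j => X (KAF.orbit Φ Δt ω₁ j)) n))
    (heigEmp : ∀ n, KAF.IsEigensystem
      (KAF.kernelOp (𝓚Emp n) (KAF.empMeasure (fun j => X (KAF.orbit Φ Δt ω₁ j)) n))
      (lamEmp n) (φEmp n)) :
    -- the regression function represents the conditional expectation
    (∀ τ, MemLp (Y ∘ Φ τ) 2 μ ∧
      (fun ω => KAF.regression μ hX.measurable (Y ∘ Φ τ) (X ω))
        =ᵐ[μ] μ[Y ∘ Φ τ | MeasurableSpace.comap X inferInstance]) ∧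
    -- convergence of the empirical to the ideal target functions, uniformly on `U`,
    -- for each lead time, and uniformly over the lead times in compact sets
    (∀ ℓ : ℕ, 1 ≤ ℓ → 0 < lam (ℓ - 1) → lam ℓ < lam (ℓ - 1) →
      (∀ q : ℕ, TendstoUniformlyOn
        (fun n x => KAF.empTarget (fun j => X (KAF.orbit Φ Δt ω₁ j))
          (fun j => Y (KAF.orbit Φ Δt ω₁ j)) n (𝓚Emp n) (lamEmp n) (φEmp n) q ℓ x)
        (fun x => KAF.idealTarget μ hX.measurable 𝓚 lam φ (Y ∘ Φ (q * Δt)) ℓ x) atTop U) ∧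
      ∀ T : Set ℝ≥0, IsCompact T → TendstoUniformlyOn
        (fun n (p : ℕ × 𝒳) => KAF.empTarget (fun j => X (KAF.orbit Φ Δt ω₁ j))
          (fun j => Y (KAF.orbit Φ Δt ω₁ j)) n (𝓚Emp n) (lamEmp n) (φEmp n) p.1 ℓ p.2)
        (fun p => KAF.idealTarget μ hX.measurable 𝓚 lam φ (Y ∘ Φ (p.1 * Δt)) ℓ p.2) atTop
        ({q : ℕ | q * Δt ∈ T} ×ˢ U)) ∧
    -- convergence of the ideal target functions to the regression function in `L²`,
    -- for each lead time, and uniformly over the lead times in compact sets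
    (KAF.IsL2StrictlyPositive 𝓚 (μ.map X) →
      (∀ τ, Tendsto
        (fun ℓ => KAF.incl 𝓚 (μ.map X)
          (KAF.idealTarget μ hX.measurable 𝓚 lam φ (Y ∘ Φ τ) ℓ)) atTop
        (𝓝 (KAF.regression μ hX.measurable (Y ∘ Φ τ)))) ∧
      (∀ T : Set ℝ≥0, IsCompact T → TendstoUniformlyOn
        (fun ℓ τ => KAF.incl 𝓚 (μ.map X)
          (KAF.idealTarget μ hX.measurable 𝓚 lam φ (Y ∘ Φ τ) ℓ))
        (fun τ => KAF.regression μ hX.measurable (Y ∘ Φ τ)) atTop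
        (T ∩ {τ | ∃ q : ℕ, τ = q * Δt})) ∧
      ((∀ ω, Continuous fun t => Φ t ω) → ∀ T : Set ℝ≥0, IsCompact T → TendstoUniformlyOn
        (fun ℓ τ => KAF.incl 𝓚 (μ.map X)
          (KAF.idealTarget μ hX.measurable 𝓚 lam φ (Y ∘ Φ τ) ℓ))
        (fun τ => KAF.regression μ hX.measurable (Y ∘ Φ τ)) atTop T)) := by
  have hV : ∀ᵐ ω ∂μ, ω ∈ μ.support := KAF.ae_mem_support_of_ae_mem_isSeparable
    (countable_range (KAF.orbit Φ Δt ω₁)).isSeparable.closure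
    (KAF.ae_mem_closure_range_of_tendsto hweak)
  have hS : KAF.Samples (KAF.orbit Φ Δt ω₁) μ (X ⁻¹' U) :=
    KAF.samples_of_tendsto_integral hweak hUdata (hV.mono fun ω hω =>
      hUsupp (KAF.mem_support_map_of_mem_support hX hω))
  -- `Y` is bounded on the compact support, and invariance of `μ` transfers the same bound to every
  -- `Y ∘ Φ τ`. Its independence of `τ` gives the domination for continuity in the lead time.
  obtain ⟨M, hM⟩ := hμ.exists_bound_of_continuousOn hY.continuousOn
  have hbound : ∀ τ, ∀ᵐ ω ∂μ, ‖(Y ∘ Φ τ) ω‖ ≤ M := fun τ =>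
    (hΦμ τ).quasiMeasurePreserving.ae (hV.mono hM)
  have hcont : ∀ τ, Continuous (Y ∘ Φ τ) := fun τ => hY.comp (hΦc τ)
  have hL : ∀ τ, MemLp (Y ∘ Φ τ) 2 μ := fun τ =>
    MemLp.of_bound (hcont τ).aestronglyMeasurable M (hbound τ)
  refine ⟨fun τ => ⟨hL τ, KAF.regression_comp_ae_eq_condExp hX.measurable (hL τ)⟩, ?_, ?_⟩
  · intro ℓ hℓ _ hgap
    have key : ∀ q : ℕ, TendstoUniformlyOn
        (fun n x => KAF.empTarget (fun j => X (KAF.orbit Φ Δt ω₁ j))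
          (fun j => Y (KAF.orbit Φ Δt ω₁ j)) n (𝓚Emp n) (lamEmp n) (φEmp n) q ℓ x)
        (fun x => KAF.idealTarget μ hX.measurable 𝓚 lam φ (Y ∘ Φ (q * Δt)) ℓ x) atTop U := by
      intro q
      refine hS.tendsto_empTarget hX hU hk hkEmp hkconv heig heigEmp hℓ hgap (hcont _) (hYbdd q)
        (hL _) fun j => ?_
      -- By the semigroup law, shifting the data by `q` steps evaluates `Y ∘ Φ (q * Δt)` along the
      -- orbit.
      simp only [KAF.orbit, Function.comp_apply]
      rw [← Function.comp_apply (f := Φ (q * Δt)), ← hΦadd, ← add_mul, add_comm (q : ℝ≥0),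
        Nat.cast_add]
    exact ⟨key, fun T hT => KAF.tendstoUniformlyOn_finite_prod
      (KAF.finite_setOf_natCast_mul_mem hΔt hT) fun q _ => key q⟩
  · intro hpos
    have hpos' : ∀ f, f ≠ 0 → KAF.kernelOp 𝓚 (μ.map X) f ≠ 0 := by
      intro f hf h0
      have := hpos f hf
      rw [h0, inner_zero_right] at this
      exact lt_irrefl _ this
    have key := fun τ => KAF.IsEigensystem.tendsto_apply_target heig hpos'
      (KAF.regression μ hX.measurable (Y ∘ Φ τ))
    refine ⟨key, fun T hT => ?_, fun hΦt T hT => ?_⟩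
    -- A compact set contains only finitely many sampled lead times, so uniformity needs no
    -- continuity in time.
    · have hfin : (T ∩ {τ | ∃ q : ℕ, τ = q * Δt}).Finite := by
        refine ((KAF.finite_setOf_natCast_mul_mem hΔt hT).image fun q : ℕ => q * Δt).subset ?_
        rintro _ ⟨hτ, q, rfl⟩
        exact ⟨q, hτ, rfl⟩
      rw [Metric.tendstoUniformlyOn_iff]
      intro ε hε
      refine (Set.Finite.eventually_all hfin).2 fun τ _ => ?_
      filter_upwards [Metric.tendsto_nhds.1 (key τ) ε hε] with ℓ hℓ
      rw [dist_comm]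
      exact hℓ
    · refine KAF.IsEigensystem.tendstoUniformlyOn_apply_target heig hpos' hT ?_
      simp only [KAF.regression_eq hX.measurable (hL _)]
      exact (ContinuousLinearMap.continuous _).comp (KAF.continuous_toLp_of_bounded
        (fun τ => (hcont τ).measurable) hL hbound fun ω => hY.comp (hΦt ω))
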